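/- Let $\mathbb D$ be the open unit disk in $\mathbb C$ and $d(z)=1-|z|$ the distance from $z\in\mathbb D$ to $\partial\mathbb D$. For $0<p<\infty$, $0\le r<1$ and $g$ continuous on $\mathbb D$ put $M_p(r,g)=\left(\frac1{2\pi}\int_0^{2\pi}|g(re^{i\theta})|^p\,d\theta\right)^{1/p}$. A *majorant* is a continuous increasing (i.e. non-decreasing) function $\omega:[0,\infty)\to[0,\infty)$, not identically zero, with $\omega(0)=0$ and $\omega(t)/t$ non-increasing for $t>0$. For $p\in(0,\infty)$, $\alpha>0$, $\beta\in\mathbb R$ and a majorant $\omega$, let $\mathcal L_{p,\omega}\mathcal B^\beta_\alpha(\mathbb D)$ be the space of all complex-valued $f\in C^1(\mathbb D)$ with $$\|f\|_{\mathcal L_{p,\omega}\mathcal B^\beta_\alpha(\mathbb D)}=|f(0)|+\sup_{z\in\mathbb D}\left\{M_p(|z|,\|D_f\|)\,\omega\!\left(d^\alpha(z)\left(\log\frac{e}{d(z)}\right)^{\beta}\right)\right\}<\infty,$$ where $\|D_f\|=|f_z|+|f_{\bar z}|$ is the operator norm of the real derivative of $f$. (a) Let $\omega$ be a majorant, $p\in[2,\infty)$,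 $\alpha>0$, $\beta\le\alpha$, and let $\lambda:\mathbb D\to[0,\infty)$ be continuous with $\sup_{z\in\mathbb D}\lambda(z)<\frac4p$. If $f\in C^2(\mathbb D)$ is a complex-valued solution of $\Delta f=\lambda f$ in $\mathbb D$ and $f\in\mathcal L_{p,\omega}\mathcal B^\beta_\alpha(\mathbb D)$, then for all $r\in(0,1)$ $$M_p(r,f)\le C_\lambda^p(r)\left[|f(0)|^2+\left(\frac{rp\,\|f\|_{\mathcal L_{p,\omega}\mathcal B^\beta_\alpha(\mathbb D)}}{\omega(1)}\right)^2\int_0^1\frac{(1-t)\,dt}{d^{2\alpha}(rt)\left(\log\frac e{d(rt)}\right)^{2\beta}}\right]^{1/2},\qquad C_\lambda^p(r)=\frac1{1-\frac{pr^2}{4}\sup_{z\in\mathbb D}\lambda(z)}.$$ (b) In particular, if $p\in[2,\infty)$, $\omega(t)=t$, $\alpha=1$, $\beta=0$, $\lambda\equiv0$, and $f\in C^2(\mathbb D)\cap\mathcal L_{p,\omega}\mathcal B^0_1(\mathbb D)$ satisfies $\Delta f=0$ in $\mathbb D$, then $$M_p(r,f)=O\left(\left(\log\frac1{1-r}\right)^{1/2}\right)\quad\text{as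 } r\to1^-.$$ (c) The estimate in (b) is sharp: the series $f(z)=\sum_{n=0}^\infty z^{2^n}$ converges in $\mathbb D$, $f$ satisfies the hypotheses of (b) for every $p\in[2,\infty)$, and $M_p(r,f)\asymp\left(\log\frac1{1-r}\right)^{1/2}$ as $r\to1^-$, i.e. each side is $O$ of the other. -/

import Mathlib

open Set Filter Topology Asymptotics
open scoped Real

noncomputable section

namespace YukawaBloch

/-- The open unit disk of the complex plane. -/
def disk : Set ℂ := Metric.ball 0 1

/-- The Euclidean distance from `z` to the boundary of the unit disk. -/
def d (z : ℂ) : ℝ := Metric.infDist z (frontier disk)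

theorem d_eq {z : ℂ} (hz : z ∈ disk) : d z = 1 - ‖z‖ := by
  have hz1 : ‖z‖ < 1 := by simpa [disk] using hz
  have hfr : frontier disk = Metric.sphere (0 : ℂ) 1 := by
    unfold disk
    exact frontier_ball _ one_ne_zero
  unfold d
  rw [hfr]
  apply le_antisymm
  · by_cases h0 : z = 0
    · subst h0
      have h1 : (1 : ℂ) ∈ Metric.sphere (0 : ℂ) 1 := by simp
      simpa using Metric.infDist_le_dist_of_mem (x := (0 : ℂ)) h1
    · have hn : ‖z‖ ≠ 0 := by simpa using h0
      have h1 : z / (‖z‖ : ℂ) ∈ Metric.sphere (0 : ℂ) 1 := by simp [hn]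
      refine (Metric.infDist_le_dist_of_mem h1).trans (le_of_eq ?_)
      have h2 : z / (‖z‖ : ℂ) - z = ((1 - ‖z‖ : ℝ) : ℂ) * (z / (‖z‖ : ℂ)) := by
        have : (‖z‖ : ℂ) ≠ 0 := by exact_mod_cast hn
        push_cast
        field_simp
      rw [dist_comm, dist_eq_norm, h2, norm_mul, Complex.norm_real,
        Real.norm_of_nonneg (by linarith)]
      simp [hn]
  · rw [Metric.le_infDist ⟨1, by simp⟩]
    intro y hy
    have hy1 : ‖y‖ = 1 := by simpa using hy
    have := norm_sub_norm_le y z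
    rw [dist_comm, dist_eq_norm]
    linarith

/-- A majorant, as a function on `[0, ∞)` (its values at negative reals play no role):
continuous, increasing, zero at the origin, with `ω t / t` non-increasing for `t > 0`, and not
identically zero. -/
structure IsMajorant (ω : ℝ → ℝ) : Prop where
  continuousOn : ContinuousOn ω (Ici 0)
  monotoneOn : MonotoneOn ω (Ici 0)
  map_zero : ω 0 = 0
  antitoneOn : AntitoneOn (fun t => ω t / t) (Ioi 0)
  exists_ne_zero : ∃ t, 0 < t ∧ ω t ≠ 0

/-- The integral mean `M_p(r, g)`, for a finite exponent `p`: `M_p(r, g) ^ p` is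
`(1 / 2π) ∫ θ in 0..2π, ‖g (r e^{iθ})‖ ^ p`. -/
def integralMean {E : Type*} [NormedAddCommGroup E] (p r : ℝ) (g : ℂ → E) : ℝ :=
  Real.circleAverage (fun z => ‖g z‖ ^ p) 0 r ^ (1 / p)

/-- The quantity `M_p(|z|, ‖D_f‖) ω(d(z) ^ α (log (e / d(z))) ^ β)`; `‖D_f‖` is the operator norm
of the real derivative of `f` for the Euclidean norm of the plane. -/
def blochQuantity (p : ℝ) (ω : ℝ → ℝ) (α β : ℝ) (f : ℂ → ℂ) (z : ℂ) : ℝ :=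
  integralMean p ‖z‖ (fun w => ‖fderiv ℝ f w‖) *
    ω (d z ^ α * Real.log (Real.exp 1 / d z) ^ β)

/-- The norm of the generalized Bloch-type space, for a finite exponent `p`
(meaningful when `f` belongs to the space, so that the supremum is finite). -/
def blochNorm (p : ℝ) (ω : ℝ → ℝ) (α β : ℝ) (f : ℂ → ℂ) : ℝ :=
  ‖f 0‖ + sSup (blochQuantity p ω α β f '' disk)

/-- Membership in the generalized Bloch-type space, for a finite exponent `p`: `f` is continuously
differentiable (in the real sense) on the disk and its norm is finite. -/
def MemBloch (p : ℝ) (ω : ℝ → ℝ) (α β : ℝ) (f : ℂ → ℂ) : Prop :=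
  ContDiffOn ℝ 1 f disk ∧ BddAbove (blochQuantity p ω α β f '' disk)

/-- `f` is a `C²` solution in the unit disk of the non-homogeneous Yukawa equation
`Δ f = lam f`. -/
def IsYukawaSolution (lam : ℂ → ℝ) (f : ℂ → ℂ) : Prop :=
  ContDiffOn ℝ 2 f disk ∧ ∀ z ∈ disk, Laplacian.laplacian f z = (lam z : ℂ) * f z

/-- The constant `C_lam^p(r) = 1 / (1 - (p r² / 4) sup lam)`. -/
def yukawaConst (lam : ℂ → ℝ) (p r : ℝ) : ℝ :=
  1 / (1 - p * r ^ 2 / 4 * sSup (lam '' disk))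

/-- The lacunary power series `∑ z ^ (2 ^ n)`. -/
def lacunary (z : ℂ) : ℂ := ∑' n : ℕ, z ^ (2 ^ n)

end YukawaBloch

end

namespace YukawaBloch

/-! For (a), fix `ε > 0` and let `U = (‖f‖² + ε)^(p/2)`, which is `C²` even at zeros of `f`. Since
`p ≥ 2` and `λ ≥ 0`, `U` is subharmonic, so its circle averages `A(t)` increase with `t`; moreover
`ΔU ≤ pΛU + p² U^(1-2/p) ‖Df‖²` with `Λ = sup λ` (`laplacian_regPow_le`). Hölder bounds the average
of the last term by `A(t)^(1-2/p) M_p(t, ‖Df‖)²`. The majorant satisfies `ω(x) ≥ x ω(1)` on `(0,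
1]`, and `β ≤ α` keeps the weight `d^α log(e/d)^β` in that range, so the Bloch norm controls `M_p(t,
‖Df‖)`. With `P = A(r)`, Green's formula `P - U(0) = r² ∫₀¹ avg(ΔU)(rs) s log(1/s) ds`
(`circleAverage_sub_le_integral` states the inequality needed), `A(rs) ≤ P`, `∫₀¹ s log(1/s) ds =
1/4` and `s log(1/s) ≤ 1 - s` give an inequality in `P` alone. Dividing by `P^(1-2/p)` and letting
`ε → 0` proves the estimate.

For (b), the constant is `1` and the integral is at most `∫₀¹ dt/(1-rt) = r⁻¹ log(1/(1-r))`.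

For (c), condensation gives `‖f'‖ ≤ 2/(1-‖z‖)`, hence membership and the upper bound. The functional
equation `f(z) = z + f(z²)` and the parallelogram law give `M₂(r)² = r² + M₂(r²)²`. Iterating it
about `log(1/(1-r))` times, with terms at least `1/2`, bounds `M₂` from below, and `M₂ ≤ M_p`. -/

/-! ### Circle averages and Green's formula. Radii range over `(-1, 1)`, so that `0` is an interior
point. -/

theorem isOpen_disk : IsOpen disk := Metric.isOpen_ball

theorem mem_disk {z : ℂ} : z ∈ disk ↔ ‖z‖ < 1 := by simp [disk]

theorem circleMap_mem_disk {t : ℝ} (ht : t ∈ Ioo (-1 : ℝ) 1) (θ : ℝ) : circleMap 0 t θ ∈ disk := by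
  rw [mem_disk, norm_circleMap_zero, abs_lt]
  exact ht

theorem sphere_subset_disk {t : ℝ} (ht : t ∈ Ioo (-1 : ℝ) 1) :
    Metric.sphere (0 : ℂ) |t| ⊆ disk := by
  intro z hz
  rw [mem_disk, mem_sphere_zero_iff_norm.1 hz, abs_lt]
  exact ht

theorem circleIntegrable_of_continuousOn_disk {g : ℂ → ℝ} (hg : ContinuousOn g disk) {t : ℝ}
    (ht : t ∈ Ioo (-1 : ℝ) 1) : CircleIntegrable g 0 t :=
  (hg.mono (sphere_subset_disk ht)).circleIntegrable'

/-- Differentiation under the integral sign on a compact interval, for jointly continuous data. -/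
theorem hasDerivAt_intervalIntegral_of_continuousOn {F F' : ℝ → ℝ → ℝ} {J : Set ℝ} {a b : ℝ}
    (hJ : IsOpen J) (hF : ContinuousOn (fun q : ℝ × ℝ => F q.1 q.2) (J ×ˢ univ))
    (hF' : ContinuousOn (fun q : ℝ × ℝ => F' q.1 q.2) (J ×ˢ univ))
    (hd : ∀ t ∈ J, ∀ θ, HasDerivAt (fun x => F x θ) (F' t θ) t) {t : ℝ} (ht : t ∈ J) :
    HasDerivAt (fun x => ∫ θ in a..b, F x θ) (∫ θ in a..b, F' t θ) t := by
  have slice : ∀ {G : ℝ → ℝ → ℝ}, ContinuousOn (fun q : ℝ × ℝ => G q.1 q.2) (J ×ˢ univ) →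
      ∀ x ∈ J, Continuous (G x) := fun {G} hG x hx =>
    hG.comp_continuous (f := fun θ => (x, θ)) (by fun_prop) fun θ => ⟨hx, mem_univ _⟩
  obtain ⟨δ, hδ, hball⟩ := Metric.nhds_basis_closedBall.mem_iff.1 (hJ.mem_nhds ht)
  obtain ⟨C, hC⟩ := ((isCompact_closedBall t δ).prod (isCompact_uIcc (a := a) (b := b)))
    |>.exists_bound_of_continuousOn (hF'.mono (prod_mono hball (subset_univ _)))
  refine (intervalIntegral.hasDerivAt_integral_of_dominated_loc_of_deriv_le
    (bound := fun _ => C) (Metric.closedBall_mem_nhds t hδ) ?_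
    ((slice hF t ht).intervalIntegrable _ _) (slice hF' t ht).aestronglyMeasurable ?_
    intervalIntegrable_const ?_).2
  · filter_upwards [hJ.mem_nhds ht] with x hx using (slice hF x hx).aestronglyMeasurable
  · exact Eventually.of_forall fun θ hθ x hx => hC (x, θ) ⟨hx, uIoc_subset_uIcc hθ⟩
  · exact Eventually.of_forall fun θ _ x hx => hd x (hball hx) θ

/-- The Laplacian in the plane, computed in a rotated frame. -/
theorem laplacian_eq_rotated {F : Type*} [NormedAddCommGroup F] [NormedSpace ℝ F] (U : ℂ → F)
    (z : ℂ) (θ : ℝ) :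
    Laplacian.laplacian U z =
      fderiv ℝ (fderiv ℝ U) z (circleMap 0 1 θ) (circleMap 0 1 θ) +
      fderiv ℝ (fderiv ℝ U) z (Complex.I * circleMap 0 1 θ) (Complex.I * circleMap 0 1 θ) := by
  have he : circleMap 0 1 θ = Real.cos θ • (1 : ℂ) + Real.sin θ • Complex.I := by
    simp [circleMap, Complex.exp_mul_I]
  have hie : Complex.I * circleMap 0 1 θ = Real.cos θ • Complex.I - Real.sin θ • (1 : ℂ) := by
    rw [he]
    simp only [Complex.real_smul]
    linear_combination (Real.sin θ : ℂ) * Complex.I_mul_I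
  rw [InnerProductSpace.laplacian_eq_iteratedFDeriv_complexPlane, hie, he]
  simp only [iteratedFDeriv_two_apply, map_add, map_sub, map_smul,
    add_apply, sub_apply, smul_apply, Matrix.cons_val_zero, Matrix.cons_val_one]
  have h := Real.sin_sq_add_cos_sq θ
  set a := fderiv ℝ (fderiv ℝ U) z 1 1
  set b := fderiv ℝ (fderiv ℝ U) z Complex.I Complex.I
  have h1 : a + b = (Real.sin θ ^ 2 + Real.cos θ ^ 2) • a +
    (Real.sin θ ^ 2 + Real.cos θ ^ 2) • b := by rw [h]; simp
  rw [h1]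
  module

/-- The circle average of the radial derivative. -/
noncomputable def radialDerivAverage (U : ℂ → ℝ) (t : ℝ) : ℝ :=
  (2 * π)⁻¹ * ∫ θ in (0 : ℝ)..2 * π, fderiv ℝ U (circleMap 0 t θ) (circleMap 0 1 θ)

theorem continuousOn_comp_circleMap {F : Type*} [TopologicalSpace F] {g : ℂ → F}
    (hg : ContinuousOn g disk) :
    ContinuousOn (fun q : ℝ × ℝ => g (circleMap 0 q.1 q.2)) (Ioo (-1 : ℝ) 1 ×ˢ univ) := by
  refine hg.comp (Continuous.continuousOn ?_) fun q hq => circleMap_mem_disk hq.1 q.2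
  simp only [circleMap]
  fun_prop

theorem contDiffOn_fderiv_disk {U : ℂ → ℝ} (hU : ContDiffOn ℝ 2 U disk) :
    ContDiffOn ℝ 1 (fderiv ℝ U) disk :=
  hU.fderiv_of_isOpen isOpen_disk (by norm_num)

theorem continuousOn_fderiv_fderiv_disk {U : ℂ → ℝ} (hU : ContDiffOn ℝ 2 U disk) :
    ContinuousOn (fderiv ℝ (fderiv ℝ U)) disk :=
  (contDiffOn_fderiv_disk hU).continuousOn_fderiv_of_isOpen isOpen_disk le_rfl

theorem continuousOn_laplacian_disk {U : ℂ → ℝ} (hU : ContDiffOn ℝ 2 U disk) :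
    ContinuousOn (Laplacian.laplacian U) disk := by
  have h := continuousOn_fderiv_fderiv_disk hU
  refine ContinuousOn.congr ?_ fun z _ => laplacian_eq_rotated U z 0
  fun_prop

theorem hasDerivAt_circleMap_radius (t θ : ℝ) :
    HasDerivAt (fun x : ℝ => circleMap 0 x θ) (circleMap 0 1 θ) t := by
  simp only [circleMap, zero_add]
  simpa using (Complex.ofRealCLM.hasDerivAt (x := t)).mul_const (Complex.exp (θ * Complex.I))

theorem hasDerivAt_circleAverage {U : ℂ → ℝ} (hU : ContDiffOn ℝ 2 U disk) {t : ℝ}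
    (ht : t ∈ Ioo (-1 : ℝ) 1) :
    HasDerivAt (fun x => Real.circleAverage U 0 x) (radialDerivAverage U t) t := by
  simp only [Real.circleAverage_def, smul_eq_mul, radialDerivAverage]
  refine HasDerivAt.const_mul _ (hasDerivAt_intervalIntegral_of_continuousOn
    (F' := fun t θ => fderiv ℝ U (circleMap 0 t θ) (circleMap 0 1 θ)) isOpen_Ioo
    (continuousOn_comp_circleMap hU.continuousOn) ?_ ?_ ht)
  · exact (continuousOn_comp_circleMap (contDiffOn_fderiv_disk hU).continuousOn).clm_apply
      (by fun_prop)
  · intro x hx θ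
    have hz := circleMap_mem_disk hx θ
    exact (((hU.differentiableOn (by norm_num)).differentiableAt
      (isOpen_disk.mem_nhds hz)).hasFDerivAt).comp_hasDerivAt x (hasDerivAt_circleMap_radius x θ)

/-- The derivative of `t * radialDerivAverage U t` says nothing about continuity of the second
factor at `t = 0`, which Green's formula needs. A second differentiation under the integral supplies
it. -/
theorem continuousOn_radialDerivAverage {U : ℂ → ℝ} (hU : ContDiffOn ℝ 2 U disk) :
    ContinuousOn (radialDerivAverage U) (Ioo (-1 : ℝ) 1) := by
  have hD := contDiffOn_fderiv_disk hU
  have h2 := continuousOn_fderiv_fderiv_disk hU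
  intro t ht
  refine (HasDerivAt.const_mul (2 * π)⁻¹ (hasDerivAt_intervalIntegral_of_continuousOn
    (F := fun t θ => fderiv ℝ U (circleMap 0 t θ) (circleMap 0 1 θ))
    (F' := fun t θ => fderiv ℝ (fderiv ℝ U) (circleMap 0 t θ) (circleMap 0 1 θ) (circleMap 0 1 θ))
    isOpen_Ioo ?_ ?_ ?_ ht)).continuousAt.continuousWithinAt
  · exact (continuousOn_comp_circleMap hD.continuousOn).clm_apply (by fun_prop)
  · exact ((continuousOn_comp_circleMap h2).clm_apply (by fun_prop)).clm_apply (by fun_prop)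
  · intro x hx θ
    have hz := circleMap_mem_disk hx θ
    have h := (((hD.differentiableOn one_ne_zero).differentiableAt
      (isOpen_disk.mem_nhds hz)).hasFDerivAt).comp_hasDerivAt x (hasDerivAt_circleMap_radius x θ)
    simpa using h.clm_apply (hasDerivAt_const x (circleMap 0 1 θ))

/-- This is the polar identity `(t A')' = t avg(ΔU)`. Differentiating in `t` yields only the radial
part `U_r + t U_rr`. The missing tangential part is a full `θ`-derivative of a periodic function, so
it may be added at no cost. -/
theorem hasDerivAt_mul_radialDerivAverage {U : ℂ → ℝ} (hU : ContDiffOn ℝ 2 U disk) {t : ℝ}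
    (ht : t ∈ Ioo (-1 : ℝ) 1) :
    HasDerivAt (fun x => x * radialDerivAverage U x)
      (t * Real.circleAverage (Laplacian.laplacian U) 0 t) t := by
  have hD := contDiffOn_fderiv_disk hU
  have h2 := continuousOn_fderiv_fderiv_disk hU
  have hdiff : ∀ x ∈ Ioo (-1 : ℝ) 1, ∀ θ, HasFDerivAt (fderiv ℝ U)
      (fderiv ℝ (fderiv ℝ U) (circleMap 0 x θ)) (circleMap 0 x θ) := fun x hx θ =>
    ((hD.differentiableOn one_ne_zero).differentiableAt
      (isOpen_disk.mem_nhds (circleMap_mem_disk hx θ))).hasFDerivAt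
  have hsmul : ∀ x θ : ℝ, circleMap 0 x θ = x • circleMap 0 1 θ := by
    intro x θ; simp [circleMap]
  set e : ℝ → ℂ := circleMap 0 1 with he
  have hecont : Continuous e := by fun_prop
  have hed : ∀ θ, HasDerivAt e (Complex.I * e θ) θ := fun θ => by
    simpa [mul_comm] using hasDerivAt_circleMap 0 1 θ
  have hF : HasDerivAt (fun x => ∫ θ in (0 : ℝ)..2 * π, x * fderiv ℝ U (circleMap 0 x θ) (e θ))
      (∫ θ in (0 : ℝ)..2 * π, (fderiv ℝ U (circleMap 0 t θ) (e θ) +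
        t * fderiv ℝ (fderiv ℝ U) (circleMap 0 t θ) (e θ) (e θ))) t := by
    refine hasDerivAt_intervalIntegral_of_continuousOn
      (F' := fun t θ => fderiv ℝ U (circleMap 0 t θ) (e θ) +
        t * fderiv ℝ (fderiv ℝ U) (circleMap 0 t θ) (e θ) (e θ)) isOpen_Ioo ?_ ?_ ?_ ht
    · exact continuousOn_fst.mul
        ((continuousOn_comp_circleMap hD.continuousOn).clm_apply (by fun_prop))
    · exact ((continuousOn_comp_circleMap hD.continuousOn).clm_apply (by fun_prop)).add
        (continuousOn_fst.mul
          (((continuousOn_comp_circleMap h2).clm_apply (by fun_prop)).clm_apply (by fun_prop)))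
    · intro x hx θ
      have h := (hdiff x hx θ).comp_hasDerivAt x (hasDerivAt_circleMap_radius x θ)
      convert! (hasDerivAt_id x).mul (h.clm_apply (hasDerivAt_const x (e θ))) using 1
      simp [he]
  have hP : ∀ θ, HasDerivAt (fun θ => fderiv ℝ U (circleMap 0 t θ) (Complex.I * e θ))
      (t * fderiv ℝ (fderiv ℝ U) (circleMap 0 t θ) (Complex.I * e θ) (Complex.I * e θ) -
        fderiv ℝ U (circleMap 0 t θ) (e θ)) θ := by
    intro θ
    have h1 : HasDerivAt (circleMap 0 t) (t • (Complex.I * e θ)) θ := by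
      convert! hasDerivAt_circleMap 0 t θ using 1
      rw [hsmul t θ]
      simp [mul_comm, mul_left_comm]
    have h := ((hdiff t ht θ).comp_hasDerivAt θ h1).clm_apply ((hed θ).const_mul Complex.I)
    convert! h using 1
    rw [← mul_assoc Complex.I Complex.I, Complex.I_mul_I, map_smul, smul_apply]
    simp [sub_eq_add_neg]
  have cslice : ∀ {F : Type} [TopologicalSpace F] {g : ℂ → F}, ContinuousOn g disk →
      Continuous fun θ => g (circleMap 0 t θ) := fun hg =>
    hg.comp_continuous (by fun_prop) fun θ => circleMap_mem_disk ht θ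
  have hcD := cslice hD.continuousOn
  have hc2 := cslice h2
  have hcP : Continuous fun θ =>
      (t * fderiv ℝ (fderiv ℝ U) (circleMap 0 t θ) (Complex.I * e θ) (Complex.I * e θ) -
        fderiv ℝ U (circleMap 0 t θ) (e θ)) := by fun_prop
  -- The angular derivative of `DU(ie)`, where `e = exp(iθ)`, integrates to zero over a period.
  have hper : ∫ θ in (0 : ℝ)..2 * π,
      (t * fderiv ℝ (fderiv ℝ U) (circleMap 0 t θ) (Complex.I * e θ) (Complex.I * e θ) -
        fderiv ℝ U (circleMap 0 t θ) (e θ)) = 0 := by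
    rw [intervalIntegral.integral_eq_sub_of_hasDerivAt (fun θ _ => hP θ)
      (hcP.intervalIntegrable _ _)]
    simp [he, circleMap]
  have key : ∫ θ in (0 : ℝ)..2 * π, (fderiv ℝ U (circleMap 0 t θ) (e θ) +
        t * fderiv ℝ (fderiv ℝ U) (circleMap 0 t θ) (e θ) (e θ)) =
      t * ∫ θ in (0 : ℝ)..2 * π, Laplacian.laplacian U (circleMap 0 t θ) := by
    refine ((add_zero _).symm.trans (congrArg (_ + ·) hper.symm)).trans ?_
    rw [← intervalIntegral.integral_add, ← intervalIntegral.integral_const_mul]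
    · refine intervalIntegral.integral_congr fun θ _ => ?_
      simp only [laplacian_eq_rotated U (circleMap 0 t θ) θ]
      ring
    · exact (by fun_prop : Continuous _).intervalIntegrable _ _
    · exact hcP.intervalIntegrable _ _
  rw [key] at hF
  convert! hF.const_mul (2 * π)⁻¹ using 1
  · funext x
    rw [radialDerivAverage, intervalIntegral.integral_const_mul]
    ring
  · rw [Real.circleAverage_def, smul_eq_mul]
    ring

/-- The product of `t` with this average vanishes at `0` and has derivative `t avg(ΔU) ≥ 0`. -/
theorem radialDerivAverage_nonneg {U : ℂ → ℝ} (hU : ContDiffOn ℝ 2 U disk)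
    (hL : ∀ z ∈ disk, 0 ≤ Laplacian.laplacian U z) {t : ℝ} (ht : t ∈ Ioo (0 : ℝ) 1) :
    0 ≤ radialDerivAverage U t := by
  have hsub : ∀ x ∈ Icc 0 t, x ∈ Ioo (-1 : ℝ) 1 := fun x hx =>
    ⟨by linarith [hx.1], hx.2.trans_lt ht.2⟩
  have hmono : MonotoneOn (fun x => x * radialDerivAverage U x) (Icc 0 t) := by
    refine monotoneOn_of_hasDerivWithinAt_nonneg (convex_Icc 0 t)
      (f' := fun x => x * Real.circleAverage (Laplacian.laplacian U) 0 x)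
      (fun x hx => (hasDerivAt_mul_radialDerivAverage hU (hsub x hx)).continuousAt.continuousWithinAt)
      (fun x hx => (hasDerivAt_mul_radialDerivAverage hU
        (hsub x (interior_subset hx))).hasDerivWithinAt) fun x hx => ?_
    have hx' := interior_subset hx
    exact mul_nonneg hx'.1 (Real.circleAverage_nonneg_of_nonneg fun z hz =>
      hL z (sphere_subset_disk (hsub x hx') hz))
  have h := hmono (left_mem_Icc.2 ht.1.le) (right_mem_Icc.2 ht.1.le) ht.1.le
  simp only [zero_mul] at h
  exact nonneg_of_mul_nonneg_right h ht.1

theorem circleAverage_le_of_laplacian_nonneg {U : ℂ → ℝ} (hU : ContDiffOn ℝ 2 U disk)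
    (hL : ∀ z ∈ disk, 0 ≤ Laplacian.laplacian U z) {s t : ℝ} (hs : 0 ≤ s) (hst : s ≤ t)
    (ht : t < 1) : Real.circleAverage U 0 s ≤ Real.circleAverage U 0 t := by
  have hsub : ∀ x ∈ Icc 0 t, x ∈ Ioo (-1 : ℝ) 1 := fun x hx =>
    ⟨by linarith [hx.1], hx.2.trans_lt ht⟩
  refine monotoneOn_of_hasDerivWithinAt_nonneg (convex_Icc 0 t) (f' := radialDerivAverage U)
    (fun x hx => (hasDerivAt_circleAverage hU (hsub x hx)).continuousAt.continuousWithinAt)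
    (fun x hx => (hasDerivAt_circleAverage hU (hsub x (interior_subset hx))).hasDerivWithinAt)
    (fun x hx => ?_) ⟨hs, hst⟩ ⟨hs.trans hst, le_rfl⟩ hst
  rw [interior_Icc] at hx
  exact radialDerivAverage_nonneg hU hL ⟨hx.1, hx.2.trans ht⟩

/-- Green's formula for circle averages, as an inequality. -/
theorem circleAverage_sub_le_integral {U : ℂ → ℝ} (hU : ContDiffOn ℝ 2 U disk) {r : ℝ}
    (hr : r ∈ Ioo (0 : ℝ) 1) {φ : ℝ → ℝ} (hφ : MeasureTheory.IntegrableOn φ (Icc 0 1))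
    (hle : ∀ s ∈ Ioo (0 : ℝ) 1,
      r ^ 2 * Real.circleAverage (Laplacian.laplacian U) 0 (r * s) * Real.negMulLog s ≤ φ s) :
    Real.circleAverage U 0 r - U 0 ≤ ∫ s in (0 : ℝ)..1, φ s := by
  have hsub : ∀ s ∈ Icc (0 : ℝ) 1, r * s ∈ Ioo (-1 : ℝ) 1 := fun s hs =>
    ⟨by linarith [mul_nonneg hr.1.le hs.1], by nlinarith [hr.1, hr.2, hs.1, hs.2]⟩
  have hA : ContinuousOn (fun s => Real.circleAverage U 0 (r * s)) (Icc 0 1) := fun s hs =>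
    ((hasDerivAt_circleAverage hU (hsub s hs)).continuousAt.comp (f := fun s => r * s)
      (by fun_prop)).continuousWithinAt
  have hR : ContinuousOn (fun s => radialDerivAverage U (r * s)) (Icc 0 1) :=
    (continuousOn_radialDerivAverage hU).comp (by fun_prop) hsub
  -- The primitive is `A(rs) - (rs A'(rs)) log s`. Writing it with `negMulLog`, which is continuous
  -- and zero at `0` and `1`, makes its end values `U 0` and `A(r)`.
  have h := intervalIntegral.sub_le_integral_of_hasDeriv_right_of_le (zero_le_one' ℝ)
    (g := fun s => Real.circleAverage U 0 (r * s) +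
      r * radialDerivAverage U (r * s) * Real.negMulLog s)
    (g' := fun s => r ^ 2 * Real.circleAverage (Laplacian.laplacian U) 0 (r * s) *
      Real.negMulLog s)
    (hA.add ((continuousOn_const.mul hR).mul Real.continuous_negMulLog.continuousOn)) ?_ hφ hle
  · simpa [Real.circleAverage_def, ← mul_assoc, Real.pi_pos.ne'] using h
  · intro s hs
    have hs' := hsub s ⟨hs.1.le, hs.2.le⟩
    have hmul : HasDerivAt (fun s : ℝ => r * s) r s := by
      simpa using (hasDerivAt_id s).const_mul r
    have h1 := (hasDerivAt_circleAverage hU hs').comp s hmul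
    have h2 := ((hasDerivAt_mul_radialDerivAverage hU hs').comp s hmul).mul
      (Real.hasDerivAt_log hs.1.ne')
    refine HasDerivAt.hasDerivWithinAt ?_
    convert! h1.sub h2 using 1
    · funext x
      simp [Real.negMulLog]
      ring
    · simp only [Real.negMulLog, Function.comp]
      field_simp [hs.1.ne']
      ring

/-! ### Hölder on circles, and the gradient against the operator norm. -/

/-- Hölder's inequality for circle averages. -/
theorem circleAverage_rpow_mul_rpow_le {X Y : ℂ → ℝ} {t w P Q : ℝ} (hX : ∀ z, 0 ≤ X z)
    (hY : ∀ z, 0 ≤ Y z) (hXi : CircleIntegrable X 0 t) (hYi : CircleIntegrable Y 0 t)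
    (hXY : CircleIntegrable (fun z => X z ^ (1 - w) * Y z ^ w) 0 t) (hw0 : 0 < w) (hw1 : w ≤ 1)
    (hP : 0 < P) (hXP : Real.circleAverage X 0 t ≤ P) (hYQ : Real.circleAverage Y 0 t ≤ Q) :
    Real.circleAverage (fun z => X z ^ (1 - w) * Y z ^ w) 0 t ≤ P ^ (1 - w) * Q ^ w := by
  have hQ0 : 0 ≤ Q := (Real.circleAverage_nonneg_of_nonneg fun z _ => hY z).trans hYQ
  -- Weighted AM-GM is applied to `X / P` and `Y / R`. Since `Q` may be zero, it is replaced by `R >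
  -- Q`, and `R` then decreases to `Q`.
  have main : ∀ R, Q < R → Real.circleAverage (fun z => X z ^ (1 - w) * Y z ^ w) 0 t ≤
      P ^ (1 - w) * R ^ w := by
    intro R hQR
    have hR : 0 < R := hQ0.trans_lt hQR
    have hPR : 0 < P ^ (1 - w) * R ^ w := by positivity
    have hi : CircleIntegrable
        (((P ^ (1 - w) * R ^ w) * ((1 - w) / P)) • X + ((P ^ (1 - w) * R ^ w) * (w / R)) • Y) 0 t :=
      (hXi.const_smul).add (hYi.const_smul)
    refine (Real.circleAverage_mono hXY hi fun z _ => ?_).trans ?_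
    · have h := Real.geom_mean_le_arith_mean2_weighted (sub_nonneg.2 hw1) hw0.le
        (div_nonneg (hX z) hP.le) (div_nonneg (hY z) hR.le) (by ring)
      rw [Real.div_rpow (hX z) hP.le, Real.div_rpow (hY z) hR.le, div_mul_div_comm,
        div_le_iff₀ hPR] at h
      refine h.trans_eq ?_
      simp only [Pi.add_apply, Pi.smul_apply, smul_eq_mul]
      ring
    · rw [Real.circleAverage_add hXi.const_smul hYi.const_smul, Real.circleAverage_smul,
        Real.circleAverage_smul, smul_eq_mul, smul_eq_mul]
      have h1 : (1 - w) / P * Real.circleAverage X 0 t ≤ 1 - w := by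
        rw [div_mul_eq_mul_div, div_le_iff₀ hP]
        exact mul_le_mul_of_nonneg_left hXP (sub_nonneg.2 hw1)
      have h2 : w / R * Real.circleAverage Y 0 t ≤ w := by
        rw [div_mul_eq_mul_div, div_le_iff₀ hR]
        exact mul_le_mul_of_nonneg_left (hYQ.trans hQR.le) hw0.le
      have := mul_le_mul_of_nonneg_left (add_le_add h1 h2) hPR.le
      linarith
  have hlim : Tendsto (fun R : ℝ => P ^ (1 - w) * R ^ w) (𝓝[>] Q) (𝓝 (P ^ (1 - w) * Q ^ w)) :=
    ((Real.continuous_rpow_const hw0.le).const_mul _).continuousAt.tendsto.mono_left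
      nhdsWithin_le_nhds
  exact ge_of_tendsto hlim (eventually_mem_nhdsWithin.mono fun R hR => main R hR)

/-- A real functional on the plane is bounded by the Euclidean norm of its coordinates. -/
theorem sq_add_sq_le_opNorm_sq (L : ℂ →L[ℝ] ℝ) : L 1 ^ 2 + L Complex.I ^ 2 ≤ ‖L‖ ^ 2 := by
  -- `v` is the gradient of `L`, so that `L v = ‖v‖²`.
  set v : ℂ := L 1 • (1 : ℂ) + L Complex.I • Complex.I with hv
  have hLv : L v = L 1 ^ 2 + L Complex.I ^ 2 := by
    rw [hv, map_add, map_smul, map_smul, smul_eq_mul, smul_eq_mul, sq, sq]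
  have hnv : ‖v‖ ^ 2 = L 1 ^ 2 + L Complex.I ^ 2 := by
    rw [hv, ← Complex.normSq_eq_norm_sq, Complex.normSq_apply]
    simp [sq]
  have h := L.le_opNorm v
  rw [hLv, ← hnv, Real.norm_of_nonneg (sq_nonneg _)] at h
  rw [← hnv]
  rcases (norm_nonneg v).eq_or_lt' with h0 | h0
  · rw [h0, zero_pow two_ne_zero]
    positivity
  · exact pow_le_pow_left₀ h0.le (by nlinarith) 2

/-! ### The Laplacian of the regularised power. -/

section

variable {f : ℂ → ℂ} {ε p : ℝ}

/-- A smooth regularisation of `‖f‖ ^ p`. -/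
noncomputable def regPow (p ε : ℝ) (f : ℂ → ℂ) (z : ℂ) : ℝ := (‖f z‖ ^ 2 + ε) ^ (p / 2)

theorem contDiffOn_regPow (hf : ContDiffOn ℝ 2 f disk) (hε : 0 < ε) :
    ContDiffOn ℝ 2 (regPow p ε f) disk :=
  ((hf.norm_sq ℝ).add contDiffOn_const).rpow_const_of_ne fun z _ => by positivity

theorem hasFDerivAt_normSq_add {z : ℂ} (hf : DifferentiableAt ℝ f z) :
    HasFDerivAt (fun w => ‖f w‖ ^ 2 + ε) (2 • (innerSL ℝ (f z)).comp (fderiv ℝ f z)) z :=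
  (hf.hasFDerivAt.norm_sq).add_const ε

theorem fderiv_regPow_apply {z : ℂ} (hf : DifferentiableAt ℝ f z) (hε : 0 < ε) (w : ℂ) :
    fderiv ℝ (regPow p ε f) z w =
      p * (‖f z‖ ^ 2 + ε) ^ (p / 2 - 1) * inner ℝ (f z) (fderiv ℝ f z w) := by
  have h := (hasFDerivAt_normSq_add (ε := ε) hf).rpow_const (p := p / 2)
    (Or.inl (by positivity))
  unfold regPow
  rw [h.fderiv]
  simp
  ring

theorem laplacian_regPow (hf : ContDiffOn ℝ 2 f disk) (hε : 0 < ε) {z : ℂ} (hz : z ∈ disk) :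
    Laplacian.laplacian (regPow p ε f) z =
      p * (p - 2) * (‖f z‖ ^ 2 + ε) ^ (p / 2 - 2) *
        (inner ℝ (f z) (fderiv ℝ f z 1) ^ 2 + inner ℝ (f z) (fderiv ℝ f z Complex.I) ^ 2) +
      p * (‖f z‖ ^ 2 + ε) ^ (p / 2 - 1) *
        (‖fderiv ℝ f z 1‖ ^ 2 + ‖fderiv ℝ f z Complex.I‖ ^ 2 +
          inner ℝ (f z) (Laplacian.laplacian f z)) := by
  have hdiff : ∀ w ∈ disk, DifferentiableAt ℝ f w := fun w hw =>
    (hf.differentiableOn (by norm_num)).differentiableAt (isOpen_disk.mem_nhds hw)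
  have hD : DifferentiableAt ℝ (fderiv ℝ f) z :=
    ((hf.fderiv_of_isOpen (m := 1) isOpen_disk (by norm_num)).differentiableOn
      one_ne_zero).differentiableAt (isOpen_disk.mem_nhds hz)
  have hDU : DifferentiableAt ℝ (fderiv ℝ (regPow p ε f)) z :=
    ((contDiffOn_fderiv_disk (contDiffOn_regPow hf hε)).differentiableOn
      one_ne_zero).differentiableAt (isOpen_disk.mem_nhds hz)
  have hin : ∀ a b : ℂ, inner ℝ a b = b.re * a.re + b.im * a.im := fun a b => by
    simp [Complex.inner]
  have second : ∀ v : ℂ, fderiv ℝ (fderiv ℝ (regPow p ε f)) z v v =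
      p * (p - 2) * (‖f z‖ ^ 2 + ε) ^ (p / 2 - 2) * inner ℝ (f z) (fderiv ℝ f z v) ^ 2 +
      p * (‖f z‖ ^ 2 + ε) ^ (p / 2 - 1) *
        (‖fderiv ℝ f z v‖ ^ 2 + inner ℝ (f z) (fderiv ℝ (fderiv ℝ f) z v v)) := by
    intro v
    have h1 := hDU.hasFDerivAt.clm_apply (hasFDerivAt_const v z)
    have hDf := hD.hasFDerivAt.clm_apply (hasFDerivAt_const v z)
    have h2 := (((hasFDerivAt_normSq_add (ε := ε) (hdiff z hz)).rpow_const (p := p / 2 - 1)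
      (Or.inl (by positivity))).const_mul p).mul ((hdiff z hz).hasFDerivAt.inner ℝ hDf)
    have heq : (fun w => fderiv ℝ (regPow p ε f) w v) =ᶠ[𝓝 z]
        fun w => p * (‖f w‖ ^ 2 + ε) ^ (p / 2 - 1) * inner ℝ (f w) (fderiv ℝ f w v) := by
      filter_upwards [isOpen_disk.mem_nhds hz] with w hw
        using fderiv_regPow_apply (hdiff w hw) hε v
    have h3 := DFunLike.congr_fun (h1.unique (h2.congr_of_eventuallyEq heq)) v
    simp at h3
    rw [h3, show p / 2 - 1 - 1 = p / 2 - 2 by ring]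
    simp only [hin]
    ring
  have hL : ∀ {F : Type} [NormedAddCommGroup F] [NormedSpace ℝ F] (g : ℂ → F),
      Laplacian.laplacian g z = fderiv ℝ (fderiv ℝ g) z 1 1 +
        fderiv ℝ (fderiv ℝ g) z Complex.I Complex.I := fun g => by
    simpa [circleMap] using laplacian_eq_rotated g z 0
  rw [hL, hL f, second, second, inner_add_right]
  ring

theorem laplacian_regPow_nonneg {lam : ℂ → ℝ} (hf : IsYukawaSolution lam f) (hε : 0 < ε)
    (hp : 2 ≤ p) (hlam : ∀ z ∈ disk, 0 ≤ lam z) {z : ℂ} (hz : z ∈ disk) :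
    0 ≤ Laplacian.laplacian (regPow p ε f) z := by
  have hp2 : 0 ≤ p - 2 := by linarith
  have h : 0 ≤ inner ℝ (f z) ((lam z : ℂ) * f z) := by
    rw [← Complex.real_smul, real_inner_smul_right, real_inner_self_eq_norm_sq]
    exact mul_nonneg (hlam z hz) (sq_nonneg _)
  rw [laplacian_regPow hf.1 hε hz, hf.2 z hz]
  positivity

/-- With `S = ‖f‖² + ε`, the gradient terms contribute `p(p-2) + 2p = p²` times `S^(p/2-1) ‖Df‖²`.
The exponents `1 - 2/p` and `2/p` are displayed in the form that Hölder consumes. -/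
theorem laplacian_regPow_le {lam : ℂ → ℝ} (hf : IsYukawaSolution lam f) (hε : 0 < ε)
    (hp : 2 ≤ p) {Λ : ℝ} (hΛ0 : 0 ≤ Λ) (hΛ : ∀ z ∈ disk, lam z ≤ Λ) {z : ℂ} (hz : z ∈ disk) :
    Laplacian.laplacian (regPow p ε f) z ≤ p * Λ * regPow p ε f z +
      p ^ 2 * (regPow p ε f z ^ (1 - 2 / p) * (‖fderiv ℝ f z‖ ^ p) ^ (2 / p)) := by
  have hp0 : 0 < p := by linarith
  set S := ‖f z‖ ^ 2 + ε with hS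
  have hSpos : 0 < S := by positivity
  set D := ‖fderiv ℝ f z‖ with hDdef
  have e1 : regPow p ε f z ^ (1 - 2 / p) = S ^ (p / 2 - 1) := by
    rw [regPow, ← Real.rpow_mul hSpos.le]
    congr 1
    field_simp
  have e2 : (D ^ p) ^ (2 / p) = D ^ 2 := by
    rw [← Real.rpow_mul (norm_nonneg _), mul_div_cancel₀ _ hp0.ne', Real.rpow_two]
  have e3 : S ^ (p / 2 - 1) = S ^ (p / 2 - 2) * S := by
    rw [← Real.rpow_add_one hSpos.ne']
    congr 1
    ring
  have e4 : regPow p ε f z = S ^ (p / 2 - 1) * S := by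
    rw [regPow, ← Real.rpow_add_one hSpos.ne']
    congr 1
    ring
  have hgrad : inner ℝ (f z) (fderiv ℝ f z 1) ^ 2 + inner ℝ (f z) (fderiv ℝ f z Complex.I) ^ 2 ≤
      S * D ^ 2 := by
    have h := sq_add_sq_le_opNorm_sq ((innerSL ℝ (f z)).comp (fderiv ℝ f z))
    have h' := ContinuousLinearMap.opNorm_comp_le (innerSL ℝ (f z)) (fderiv ℝ f z)
    rw [innerSL_apply_norm] at h'
    simp only [ContinuousLinearMap.comp_apply, innerSL_apply_apply] at h
    calc _ ≤ _ := h
      _ ≤ (‖f z‖ * D) ^ 2 := pow_le_pow_left₀ (norm_nonneg _) h' 2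
      _ ≤ S * D ^ 2 := by
        rw [mul_pow]
        exact mul_le_mul_of_nonneg_right (by linarith) (sq_nonneg _)
  have hpart : ∀ v : ℂ, ‖v‖ = 1 → ‖fderiv ℝ f z v‖ ≤ D := fun v hv =>
    by simpa [hv] using (fderiv ℝ f z).le_opNorm v
  have hin : inner ℝ (f z) ((lam z : ℂ) * f z) ≤ Λ * S := by
    rw [← Complex.real_smul, real_inner_smul_right, real_inner_self_eq_norm_sq]
    exact mul_le_mul (hΛ z hz) (by linarith) (sq_nonneg _) hΛ0
  rw [laplacian_regPow hf.1 hε hz, hf.2 z hz, e1, e2, e4]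
  calc _ ≤ p * (p - 2) * S ^ (p / 2 - 2) * (S * D ^ 2) +
        p * S ^ (p / 2 - 1) * (D ^ 2 + D ^ 2 + Λ * S) := by
        have hp2 : 0 ≤ p - 2 := by linarith
        gcongr
        · exact hpart 1 (by simp)
        · exact hpart Complex.I (by simp)
    _ = _ := by
        rw [e3]
        ring

end

/-! ### Majorants, the weight, and the means of the derivative. -/

theorem IsMajorant.map_one_pos {ω : ℝ → ℝ} (hω : IsMajorant ω) : 0 < ω 1 := by
  obtain ⟨t, ht, hne⟩ := hω.exists_ne_zero
  have hpos : 0 < ω t := by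
    have h := hω.monotoneOn (self_mem_Ici) ht.le ht.le
    rw [hω.map_zero] at h
    exact lt_of_le_of_ne h hne.symm
  rcases le_total t 1 with h | h
  · exact hpos.trans_le (hω.monotoneOn ht.le (zero_le_one' ℝ) h)
  · have h1 := hω.antitoneOn (mem_Ioi.2 one_pos) (mem_Ioi.2 ht) h
    simp only [div_one] at h1
    exact (div_pos hpos ht).trans_le h1

theorem IsMajorant.mul_map_one_le {ω : ℝ → ℝ} (hω : IsMajorant ω) {x : ℝ} (hx0 : 0 < x)
    (hx1 : x ≤ 1) : x * ω 1 ≤ ω x := by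
  have h := hω.antitoneOn (mem_Ioi.2 hx0) (mem_Ioi.2 one_pos) hx1
  simp only [div_one] at h
  rwa [le_div_iff₀ hx0, mul_comm] at h

theorem one_le_log_exp_div {x : ℝ} (hx0 : 0 < x) (hx1 : x ≤ 1) :
    1 ≤ Real.log (Real.exp 1 / x) := by
  rw [Real.log_div (Real.exp_ne_zero _) hx0.ne', Real.log_exp]
  linarith [Real.log_nonpos hx0.le hx1]

/-- As `log(e/x) ≥ 1`, the exponent `β` may be raised to `α`. Then `x (1 - log x) ≤ 1` is `1 + y ≤
exp y` at `y = -log x`. -/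
theorem rpow_mul_log_rpow_le_one {x α β : ℝ} (hx0 : 0 < x) (hx1 : x ≤ 1) (hα : 0 < α)
    (hβ : β ≤ α) : x ^ α * Real.log (Real.exp 1 / x) ^ β ≤ 1 := by
  have hl := one_le_log_exp_div hx0 hx1
  calc x ^ α * Real.log (Real.exp 1 / x) ^ β
      ≤ x ^ α * Real.log (Real.exp 1 / x) ^ α := by gcongr
    _ = (x * Real.log (Real.exp 1 / x)) ^ α := (Real.mul_rpow hx0.le (by linarith)).symm
    _ ≤ 1 := by
      refine Real.rpow_le_one (mul_nonneg hx0.le (by linarith)) ?_ hα.le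
      have h := Real.add_one_le_exp (-Real.log x)
      rw [Real.exp_neg, Real.exp_log hx0] at h
      rw [Real.log_div (Real.exp_ne_zero _) hx0.ne', Real.log_exp]
      calc x * (1 - Real.log x) ≤ x * x⁻¹ := by gcongr; linarith
        _ = 1 := mul_inv_cancel₀ hx0.ne'

theorem d_ofReal {t : ℝ} (ht : t ∈ Ico (0 : ℝ) 1) : d (t : ℂ) = 1 - t := by
  have hn : ‖(t : ℂ)‖ = t := by rw [Complex.norm_real, Real.norm_of_nonneg ht.1]
  rw [d_eq (by rw [mem_disk, hn]; exact ht.2), hn]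

theorem blochQuantity_nonneg {ω : ℝ → ℝ} (hω : IsMajorant ω) {p α β : ℝ} {f : ℂ → ℂ} {z : ℂ}
    (hz : z ∈ disk) : 0 ≤ blochQuantity p ω α β f z := by
  have hz1 := mem_disk.1 hz
  have hd0 : 0 < d z := by rw [d_eq hz]; linarith
  have hd1 : d z ≤ 1 := by rw [d_eq hz]; linarith [norm_nonneg z]
  have hl := one_le_log_exp_div hd0 hd1
  have hx : 0 ≤ d z ^ α * Real.log (Real.exp 1 / d z) ^ β := by positivity
  have h := hω.monotoneOn (self_mem_Ici) hx hx
  rw [hω.map_zero] at h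
  refine mul_nonneg (Real.rpow_nonneg (Real.circleAverage_nonneg_of_nonneg fun w _ => ?_) _) h
  positivity

theorem blochQuantity_le_blochNorm {ω : ℝ → ℝ} {p α β : ℝ} {f : ℂ → ℂ}
    (hf : MemBloch p ω α β f) {z : ℂ} (hz : z ∈ disk) :
    blochQuantity p ω α β f z ≤ blochNorm p ω α β f :=
  (le_csSup hf.2 (mem_image_of_mem _ hz)).trans (le_add_of_nonneg_left (norm_nonneg _))

theorem blochNorm_nonneg {ω : ℝ → ℝ} (hω : IsMajorant ω) {p α β : ℝ} {f : ℂ → ℂ}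
    (hf : MemBloch p ω α β f) : 0 ≤ blochNorm p ω α β f :=
  (blochQuantity_nonneg hω (mem_disk.2 (by simp))).trans
    (blochQuantity_le_blochNorm hf (z := 0) (mem_disk.2 (by simp)))

theorem circleAverage_fderiv_rpow_le {ω : ℝ → ℝ} (hω : IsMajorant ω) {p α β : ℝ} (hp : 0 < p)
    (hα : 0 < α) (hβ : β ≤ α) {f : ℂ → ℂ} (hf : MemBloch p ω α β f) {t : ℝ}
    (ht : t ∈ Ico (0 : ℝ) 1) :
    Real.circleAverage (fun z => ‖fderiv ℝ f z‖ ^ p) 0 t ≤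
      (blochNorm p ω α β f /
        (ω 1 * (d (t : ℂ) ^ α * Real.log (Real.exp 1 / d (t : ℂ)) ^ β))) ^ p := by
  have hn : ‖(t : ℂ)‖ = t := by rw [Complex.norm_real, Real.norm_of_nonneg ht.1]
  have h := blochQuantity_le_blochNorm hf (z := (t : ℂ)) (by rw [mem_disk, hn]; exact ht.2)
  have hd0 : 0 < d (t : ℂ) := by rw [d_ofReal ht]; linarith [ht.2]
  have hd1 : d (t : ℂ) ≤ 1 := by rw [d_ofReal ht]; linarith [ht.1]
  have hl := one_le_log_exp_div hd0 hd1
  have hω1 := hω.map_one_pos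
  have hx0 : 0 < d (t : ℂ) ^ α * Real.log (Real.exp 1 / d (t : ℂ)) ^ β := by positivity
  have hx := hω.mul_map_one_le hx0 (rpow_mul_log_rpow_le_one hd0 hd1 hα hβ)
  have hA : 0 ≤ Real.circleAverage (fun z => ‖fderiv ℝ f z‖ ^ p) 0 t :=
    Real.circleAverage_nonneg_of_nonneg fun w _ => by positivity
  simp only [blochQuantity, integralMean, hn, norm_norm] at h
  have h2 : Real.circleAverage (fun z => ‖fderiv ℝ f z‖ ^ p) 0 t ^ (1 / p) ≤
      blochNorm p ω α β f /
        (ω 1 * (d (t : ℂ) ^ α * Real.log (Real.exp 1 / d (t : ℂ)) ^ β)) := by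
    rw [le_div_iff₀ (by positivity)]
    refine le_trans ?_ h
    rw [mul_comm (ω 1)]
    gcongr
  have h3 := Real.rpow_le_rpow (by positivity) h2 hp.le
  rwa [← Real.rpow_mul hA, one_div_mul_cancel hp.ne', Real.rpow_one] at h3

/-! ### The main estimate. -/

theorem negMulLog_le_one_sub {s : ℝ} (hs : 0 < s) : Real.negMulLog s ≤ 1 - s := by
  have h := Real.one_sub_inv_le_log_of_pos hs
  have h2 := mul_le_mul_of_nonneg_left h hs.le
  rw [mul_sub, mul_inv_cancel₀ hs.ne'] at h2
  rw [Real.negMulLog]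
  linarith

/-- This is the source of the factor `1/4` in `yukawaConst`. -/
theorem integral_negMulLog : ∫ s in (0 : ℝ)..1, Real.negMulLog s = 1 / 4 := by
  rw [intervalIntegral.integral_eq_sub_of_hasDeriv_right_of_le (zero_le_one' ℝ)
    (f := fun s => s / 2 * Real.negMulLog s + s ^ 2 / 4)]
  · norm_num
  · have := Real.continuous_negMulLog
    fun_prop
  · intro s hs
    refine HasDerivAt.hasDerivWithinAt ?_
    convert! (((hasDerivAt_id s).div_const 2).mul (Real.hasDerivAt_negMulLog hs.1.ne')).add
      ((hasDerivAt_pow 2 s).div_const 4) using 1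
    simp [Real.negMulLog]
    ring
  · exact Real.continuous_negMulLog.intervalIntegrable _ _

/-- Continuity of the integrand in the main estimate. -/
theorem continuousOn_weight {r : ℝ} (hr : r ∈ Ioo (0 : ℝ) 1) (α β : ℝ) :
    ContinuousOn (fun t : ℝ => (1 - t) / (d ((r * t : ℝ) : ℂ) ^ (2 * α) *
      Real.log (Real.exp 1 / d ((r * t : ℝ) : ℂ)) ^ (2 * β))) (Icc 0 1) := by
  have hrt : ∀ t ∈ Icc (0 : ℝ) 1, r * t ∈ Ico (0 : ℝ) 1 := fun t ht =>
    ⟨mul_nonneg hr.1.le ht.1, by nlinarith [hr.1, hr.2, ht.1, ht.2]⟩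
  have hc : ContinuousOn (fun t : ℝ => d ((r * t : ℝ) : ℂ)) (Icc 0 1) :=
    ContinuousOn.congr (f := fun t => 1 - r * t) (by fun_prop) fun t ht => d_ofReal (hrt t ht)
  have hd0 : ∀ t ∈ Icc (0 : ℝ) 1, 0 < d ((r * t : ℝ) : ℂ) := fun t ht => by
    rw [d_ofReal (hrt t ht)]; linarith [(hrt t ht).2]
  have hl : ∀ t ∈ Icc (0 : ℝ) 1, 0 < Real.log (Real.exp 1 / d ((r * t : ℝ) : ℂ)) := fun t ht =>
    one_pos.trans_le (one_le_log_exp_div (hd0 t ht)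
      (by rw [d_ofReal (hrt t ht)]; linarith [(hrt t ht).1]))
  refine ContinuousOn.div (by fun_prop) ((hc.rpow_const fun t ht => Or.inl (hd0 t ht).ne').mul
    (((continuousOn_const.div hc fun t ht => (hd0 t ht).ne').log fun t ht =>
      (div_pos (Real.exp_pos 1) (hd0 t ht)).ne').rpow_const fun t ht => Or.inl (hl t ht).ne'))
    fun t ht => ?_
  have := hd0 t ht
  have := hl t ht
  positivity

theorem circleAverage_laplacian_regPow_le {ω : ℝ → ℝ} {p α β ε : ℝ} {lam : ℂ → ℝ} {f : ℂ → ℂ}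
    (hω : IsMajorant ω) (hp : 2 ≤ p) (hα : 0 < α) (hβ : β ≤ α)
    (hlam0 : ∀ z ∈ disk, 0 ≤ lam z) {Λ : ℝ} (hΛ : ∀ z ∈ disk, lam z ≤ Λ)
    (hf : IsYukawaSolution lam f) (hfB : MemBloch p ω α β f) (hε : 0 < ε) {t : ℝ}
    (ht : t ∈ Ico (0 : ℝ) 1) {P : ℝ} (hP : 0 < P)
    (htP : Real.circleAverage (regPow p ε f) 0 t ≤ P) :
    Real.circleAverage (Laplacian.laplacian (regPow p ε f)) 0 t ≤
      p * Λ * P + p ^ 2 * (P ^ (1 - 2 / p) * (blochNorm p ω α β f / ω 1) ^ 2 /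
        (d (t : ℂ) ^ (2 * α) * Real.log (Real.exp 1 / d (t : ℂ)) ^ (2 * β))) := by
  have hp0 : 0 < p := by linarith
  have ht' : t ∈ Ioo (-1 : ℝ) 1 := ⟨by linarith [ht.1], ht.2⟩
  have hΛ0 : 0 ≤ Λ := (hlam0 0 (mem_disk.2 (by simp))).trans (hΛ 0 (mem_disk.2 (by simp)))
  have hU := contDiffOn_regPow (p := p) hf.1 hε
  have hUi := circleIntegrable_of_continuousOn_disk hU.continuousOn ht'
  have hDc : ContinuousOn (fun z => ‖fderiv ℝ f z‖ ^ p) disk :=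
    (hf.1.continuousOn_fderiv_of_isOpen isOpen_disk (by norm_num)).norm.rpow_const
      fun _ _ => Or.inr hp0.le
  have hXYi := circleIntegrable_of_continuousOn_disk
    ((hU.continuousOn.rpow_const (p := 1 - 2 / p) fun z _ => Or.inl
      (by unfold regPow; positivity)).mul
      (hDc.rpow_const (p := 2 / p) fun _ _ => Or.inr (by positivity))) ht'
  have hholder := circleAverage_rpow_mul_rpow_le (fun z => by unfold regPow; positivity)
    (fun z => by positivity) hUi (circleIntegrable_of_continuousOn_disk hDc ht') hXYi
    (by positivity) ((div_le_one hp0).2 hp) hP htP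
    (circleAverage_fderiv_rpow_le hω hp0 hα hβ hfB ht)
  set K := blochNorm p ω α β f /
    (ω 1 * (d (t : ℂ) ^ α * Real.log (Real.exp 1 / d (t : ℂ)) ^ β)) with hK
  have hd0 : 0 < d (t : ℂ) := by rw [d_ofReal ht]; linarith [ht.2]
  have hd1 : d (t : ℂ) ≤ 1 := by rw [d_ofReal ht]; linarith [ht.1]
  have hl := one_le_log_exp_div hd0 hd1
  have hl0 : 0 ≤ Real.log (Real.exp 1 / d (t : ℂ)) := by linarith
  have hK0 : 0 ≤ K := div_nonneg (blochNorm_nonneg hω hfB)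
    (mul_nonneg hω.map_one_pos.le (by positivity))
  have hK2 : (K ^ p) ^ (2 / p) = (blochNorm p ω α β f / ω 1) ^ 2 /
        (d (t : ℂ) ^ (2 * α) * Real.log (Real.exp 1 / d (t : ℂ)) ^ (2 * β)) := by
    rw [← Real.rpow_mul hK0, mul_div_cancel₀ _ hp0.ne', Real.rpow_two, hK, mul_comm 2 α,
      mul_comm 2 β, Real.rpow_mul hd0.le, Real.rpow_mul hl0, Real.rpow_two, Real.rpow_two,
      ← mul_pow, ← div_pow, div_div]
  rw [hK2] at hholder
  have hsum := (hUi.const_smul (a := p * Λ)).add (hXYi.const_smul (a := p ^ 2))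
  refine (Real.circleAverage_mono (circleIntegrable_of_continuousOn_disk
    (continuousOn_laplacian_disk hU) ht') hsum fun z hz => ?_).trans ?_
  · exact laplacian_regPow_le hf hε hp hΛ0 hΛ (sphere_subset_disk ht' hz)
  · rw [Real.circleAverage_add hUi.const_smul hXYi.const_smul, Real.circleAverage_smul,
      Real.circleAverage_smul, smul_eq_mul, smul_eq_mul]
    rw [← mul_div_assoc] at hholder
    exact add_le_add (mul_le_mul_of_nonneg_left htP (by positivity))
      (mul_le_mul_of_nonneg_left hholder (by positivity))

/-- Monotonicity of circle averages allows the single number `P`, the average at radius `r`, to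
replace all averages at smaller radii. Every term on the right then carries `P` or `P^(1-2/p)`, and
the latter is cancelled. -/
theorem circleAverage_regPow_le {ω : ℝ → ℝ} {p α β ε : ℝ} {lam : ℂ → ℝ} {f : ℂ → ℂ}
    (hω : IsMajorant ω) (hp : 2 ≤ p) (hα : 0 < α) (hβ : β ≤ α)
    (hlam0 : ∀ z ∈ disk, 0 ≤ lam z) {Λ : ℝ} (hΛ : ∀ z ∈ disk, lam z ≤ Λ)
    (hf : IsYukawaSolution lam f) (hfB : MemBloch p ω α β f) (hε : 0 < ε) {r : ℝ}
    (hr : r ∈ Ioo (0 : ℝ) 1) :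
    (1 - p * r ^ 2 / 4 * Λ) * Real.circleAverage (regPow p ε f) 0 r ^ (2 / p) ≤
      ‖f 0‖ ^ 2 + ε + (r * p * blochNorm p ω α β f / ω 1) ^ 2 *
        ∫ t in (0 : ℝ)..1, (1 - t) / (d ((r * t : ℝ) : ℂ) ^ (2 * α) *
          Real.log (Real.exp 1 / d ((r * t : ℝ) : ℂ)) ^ (2 * β)) := by
  have hp0 : 0 < p := by linarith
  have hU := contDiffOn_regPow (p := p) hf.1 hε
  have hL := fun z hz => laplacian_regPow_nonneg (p := p) (z := z) hf hε hp hlam0 hz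
  have hr0 := hr.1
  set P := Real.circleAverage (regPow p ε f) 0 r with hPdef
  set N := blochNorm p ω α β f
  set W := fun t : ℝ => (1 - t) / (d ((r * t : ℝ) : ℂ) ^ (2 * α) *
          Real.log (Real.exp 1 / d ((r * t : ℝ) : ℂ)) ^ (2 * β)) with hW
  have hU0pos : 0 < regPow p ε f 0 := by unfold regPow; positivity
  have hU0 : regPow p ε f 0 ≤ P := by
    have h := circleAverage_le_of_laplacian_nonneg hU hL le_rfl hr.1.le hr.2
    rwa [Real.circleAverage_zero] at h
  have hP : 0 < P := hU0pos.trans_le hU0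
  have hWc := continuousOn_weight hr α β
  have hΛ0 : 0 ≤ Λ := (hlam0 0 (mem_disk.2 (by simp))).trans (hΛ 0 (mem_disk.2 (by simp)))
  have hWi : IntervalIntegrable W MeasureTheory.volume 0 1 :=
    (hWc.mono (uIcc_of_le (zero_le_one' ℝ)).subset).intervalIntegrable
  have hni : IntervalIntegrable Real.negMulLog MeasureTheory.volume 0 1 :=
    Real.continuous_negMulLog.intervalIntegrable _ _
  have hgreen := circleAverage_sub_le_integral hU hr
    (φ := fun s => r ^ 2 * (p * Λ * P) * Real.negMulLog s +
      P ^ (1 - 2 / p) * (r * p * N / ω 1) ^ 2 * W s)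
    (((continuousOn_const.mul Real.continuous_negMulLog.continuousOn).add
      (continuousOn_const.mul hWc)).integrableOn_Icc) ?_
  · rw [intervalIntegral.integral_add (hni.const_mul _) (hWi.const_mul _),
      intervalIntegral.integral_const_mul, intervalIntegral.integral_const_mul,
      integral_negMulLog] at hgreen
    -- The value at the centre must also show the factor `P^(1-2/p)`; this uses `U 0 ≤ P` and `1 -
    -- 2/p ≥ 0`.
    have hU0' : regPow p ε f 0 ≤ (‖f 0‖ ^ 2 + ε) * P ^ (1 - 2 / p) := by
      have hS : 0 < ‖f 0‖ ^ 2 + ε := by positivity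
      have e : regPow p ε f 0 = (‖f 0‖ ^ 2 + ε) * regPow p ε f 0 ^ (1 - 2 / p) := by
        unfold regPow
        rw [← Real.rpow_mul hS.le, ← Real.rpow_one_add' hS.le]
        · congr 1
          field_simp
          ring
        · field_simp
          linarith
      rw [e]
      gcongr
      rw [sub_nonneg, div_le_one hp0]
      exact hp
    have hsplit : P = P ^ (2 / p) * P ^ (1 - 2 / p) := by
      rw [← Real.rpow_add hP]
      simp
    have hQ : 0 < P ^ (1 - 2 / p) := by positivity
    refine le_of_mul_le_mul_right ?_ hQ
    calc _ = P - p * r ^ 2 / 4 * Λ * P := by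
          linear_combination (-(1 - p * r ^ 2 / 4 * Λ)) * hsplit
      _ ≤ _ := by linarith
  · intro s hs
    have hrs : r * s ∈ Ico (0 : ℝ) 1 :=
      ⟨mul_nonneg hr.1.le hs.1.le, by nlinarith [hr.1, hr.2, hs.1, hs.2]⟩
    have hB := circleAverage_laplacian_regPow_le hω hp hα hβ hlam0 hΛ hf hfB hε hrs hP
      (circleAverage_le_of_laplacian_nonneg hU hL hrs.1
        (mul_le_of_le_one_right hr.1.le hs.2.le) hr.2)
    have hn0 := Real.negMulLog_nonneg hs.1.le hs.2.le
    have hd0 : 0 < d ((r * s : ℝ) : ℂ) := by rw [d_ofReal hrs]; linarith [hrs.2]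
    have hl : 0 < Real.log (Real.exp 1 / d ((r * s : ℝ) : ℂ)) := one_pos.trans_le
      (one_le_log_exp_div hd0 (by rw [d_ofReal hrs]; linarith [hrs.1]))
    set E := d ((r * s : ℝ) : ℂ) ^ (2 * α) *
      Real.log (Real.exp 1 / d ((r * s : ℝ) : ℂ)) ^ (2 * β) with hE
    have hE0 : 0 < E := by positivity
    -- The `Λ` term keeps `negMulLog` for its exact integral; in the other term it is weakened to `1
    -- - s`.
    calc _ ≤ r ^ 2 * (p * Λ * P + p ^ 2 * (P ^ (1 - 2 / p) * (N / ω 1) ^ 2 / E)) *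
          Real.negMulLog s := by gcongr
      _ = r ^ 2 * (p * Λ * P) * Real.negMulLog s +
          P ^ (1 - 2 / p) * (r * p * N / ω 1) ^ 2 * (Real.negMulLog s / E) := by ring
      _ ≤ r ^ 2 * (p * Λ * P) * Real.negMulLog s +
          P ^ (1 - 2 / p) * (r * p * N / ω 1) ^ 2 * ((1 - s) / E) := by
        gcongr
        exact negMulLog_le_one_sub hs.1

theorem integralMean_le {ω : ℝ → ℝ} {p α β : ℝ} {lam : ℂ → ℝ} {f : ℂ → ℂ}
    (hω : IsMajorant ω) (hp : 2 ≤ p) (hα : 0 < α) (hβ : β ≤ α)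
    (hlam0 : ∀ z ∈ disk, 0 ≤ lam z) (hbdd : BddAbove (lam '' disk))
    (hsup : sSup (lam '' disk) < 4 / p)
    (hf : IsYukawaSolution lam f) (hfB : MemBloch p ω α β f) {r : ℝ}
    (hr : r ∈ Ioo (0 : ℝ) 1) :
    integralMean p r f ≤ yukawaConst lam p r *
      (‖f 0‖ ^ 2 + (r * p * blochNorm p ω α β f / ω 1) ^ 2 *
        ∫ t in (0 : ℝ)..1, (1 - t) / (d ((r * t : ℝ) : ℂ) ^ (2 * α) *
          Real.log (Real.exp 1 / d ((r * t : ℝ) : ℂ)) ^ (2 * β))) ^ (1 / 2 : ℝ) := by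
  have hp0 : 0 < p := by linarith
  have hΛ : ∀ z ∈ disk, lam z ≤ sSup (lam '' disk) := fun z hz =>
    le_csSup hbdd (mem_image_of_mem _ hz)
  set Λ := sSup (lam '' disk) with hΛdef
  have hΛ0 : 0 ≤ Λ := (hlam0 0 (mem_disk.2 (by simp))).trans (hΛ 0 (mem_disk.2 (by simp)))
  set T := (r * p * blochNorm p ω α β f / ω 1) ^ 2 *
        ∫ t in (0 : ℝ)..1, (1 - t) / (d ((r * t : ℝ) : ℂ) ^ (2 * α) *
          Real.log (Real.exp 1 / d ((r * t : ℝ) : ℂ)) ^ (2 * β)) with hT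
  have hr1 : r ∈ Ioo (-1 : ℝ) 1 := ⟨by linarith [hr.1], hr.2⟩
  set c := 1 - p * r ^ 2 / 4 * Λ with hc
  have hc1 : c ≤ 1 := by
    have : 0 ≤ p * r ^ 2 / 4 * Λ := by positivity
    linarith
  have hc0 : 0 < c := by
    have h1 : p * Λ < 4 := by
      rw [lt_div_iff₀ hp0] at hsup
      linarith
    have h2 : r ^ 2 ≤ 1 := pow_le_one₀ hr.1.le hr.2.le
    have h3 : 0 ≤ p * Λ := by positivity
    nlinarith
  have hfi : CircleIntegrable (fun z => ‖f z‖ ^ p) 0 r := circleIntegrable_of_continuousOn_disk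
    (hf.1.continuousOn.norm.rpow_const fun _ _ => Or.inr hp0.le) hr1
  set A := Real.circleAverage (fun z => ‖f z‖ ^ p) 0 r with hA
  have hA0 : 0 ≤ A := Real.circleAverage_nonneg_of_nonneg fun z _ => by positivity
  have hbound : c * A ^ (2 / p) ≤ ‖f 0‖ ^ 2 + T := by
    refine le_of_forall_pos_le_add fun ε hε => ?_
    have hAP : A ≤ Real.circleAverage (regPow p ε f) 0 r := by
      refine Real.circleAverage_mono hfi (circleIntegrable_of_continuousOn_disk
        (contDiffOn_regPow hf.1 hε).continuousOn hr1) fun z _ => ?_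
      have e : ‖f z‖ ^ p = (‖f z‖ ^ 2) ^ (p / 2) := by
        rw [← Real.rpow_two, ← Real.rpow_mul (norm_nonneg _), mul_div_cancel₀ _ two_ne_zero]
      rw [regPow, e]
      gcongr
      linarith
    calc c * A ^ (2 / p) ≤ c * Real.circleAverage (regPow p ε f) 0 r ^ (2 / p) := by gcongr
      _ ≤ ‖f 0‖ ^ 2 + ε + T := circleAverage_regPow_le hω hp hα hβ hlam0 hΛ hf hfB hε hr
      _ = ‖f 0‖ ^ 2 + T + ε := by ring
  have hRHS : 0 ≤ ‖f 0‖ ^ 2 + T := le_trans (by positivity) hbound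
  -- The square root below would give the constant `(1/c)^(1/2)`. Since `1/c ≥ 1`, squaring it here
  -- weakens this to the stated `1/c`.
  have h2 : A ^ (2 / p) ≤ (1 / c) ^ 2 * (‖f 0‖ ^ 2 + T) := by
    calc A ^ (2 / p) ≤ 1 / c * (‖f 0‖ ^ 2 + T) := by
          rw [one_div, inv_mul_eq_div, le_div_iff₀ hc0]
          linarith
      _ ≤ (1 / c) ^ 2 * (‖f 0‖ ^ 2 + T) := by
          gcongr
          exact le_self_pow₀ ((one_le_div hc0).2 hc1) two_ne_zero
  have h3 := Real.rpow_le_rpow (by positivity) h2 (by norm_num : (0 : ℝ) ≤ 1 / 2)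
  rw [← Real.rpow_mul hA0, Real.mul_rpow (by positivity) hRHS, ← Real.rpow_two,
    ← Real.rpow_mul (by positivity)] at h3
  have e1 : 2 / p * (1 / 2) = 1 / p := by ring
  have e2 : (2 : ℝ) * (1 / 2) = 1 := by norm_num
  rwa [e1, e2, Real.rpow_one] at h3

/-! ### The harmonic case. -/

theorem isMajorant_id : IsMajorant fun t => t where
  continuousOn := continuousOn_id
  monotoneOn := monotoneOn_id
  map_zero := rfl
  antitoneOn := fun x hx y hy _ => by
    simp only [div_self (ne_of_gt (mem_Ioi.1 hx)), div_self (ne_of_gt (mem_Ioi.1 hy)), le_refl]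
  exists_ne_zero := ⟨1, one_pos, one_ne_zero⟩

theorem integral_inv_one_sub_mul {r : ℝ} (hr : r ∈ Ioo (0 : ℝ) 1) :
    ∫ t in (0 : ℝ)..1, (1 - r * t)⁻¹ = r⁻¹ * Real.log (1 / (1 - r)) := by
  have hpos : ∀ t ∈ uIcc (0 : ℝ) 1, 0 < 1 - r * t := fun t ht => by
    rw [uIcc_of_le zero_le_one] at ht
    nlinarith [hr.1, hr.2, ht.1, ht.2]
  rw [intervalIntegral.integral_eq_sub_of_hasDerivAt
    (f := fun t => -(r⁻¹ * Real.log (1 - r * t)))]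
  · simp
  · intro t ht
    have h1 : HasDerivAt (fun t => 1 - r * t) (-r) t := by
      simpa using ((hasDerivAt_id t).const_mul r).const_sub 1
    convert! ((h1.log (hpos t ht).ne').const_mul r⁻¹).neg using 1
    have := hr.1.ne'
    have := (hpos t ht).ne'
    field_simp
  · exact (ContinuousOn.inv₀ (by fun_prop) fun t ht => (hpos t ht).ne').intervalIntegrable

theorem harmonic_integralMean_le {p : ℝ} {f : ℂ → ℂ} (hp : 2 ≤ p)
    (hf : IsYukawaSolution (fun _ => 0) f) (hfB : MemBloch p (fun t => t) 1 0 f) {r : ℝ}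
    (hr : r ∈ Ioo (0 : ℝ) 1) :
    integralMean p r f ≤ (‖f 0‖ ^ 2 + (p * blochNorm p (fun t => t) 1 0 f) ^ 2 *
      Real.log (1 / (1 - r))) ^ (1 / 2 : ℝ) := by
  have hp0 : 0 < p := by linarith
  have himg : (fun _ : ℂ => (0 : ℝ)) '' disk = {0} :=
    Nonempty.image_const ⟨0, mem_disk.2 (by simp)⟩ 0
  have hmain := integralMean_le isMajorant_id hp one_pos zero_le_one (fun _ _ => le_rfl)
    (by rw [himg]; exact bddAbove_singleton) (by rw [himg, csSup_singleton]; positivity) hf hfB hr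
  have hC : yukawaConst (fun _ => 0) p r = 1 := by
    rw [yukawaConst, himg, csSup_singleton]; simp
  rw [hC, one_mul] at hmain
  set N := blochNorm p (fun t => t) 1 0 f
  have hr0 := hr.1
  have hrt : ∀ t ∈ Icc (0 : ℝ) 1, r * t ∈ Ico (0 : ℝ) 1 := fun t ht =>
    ⟨mul_nonneg hr.1.le ht.1, by nlinarith [hr.1, hr.2, ht.1, ht.2]⟩
  have hint : ∫ t in (0 : ℝ)..1, (1 - t) / (d ((r * t : ℝ) : ℂ) ^ (2 * (1 : ℝ)) *
          Real.log (Real.exp 1 / d ((r * t : ℝ) : ℂ)) ^ (2 * (0 : ℝ))) ≤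
      r⁻¹ * Real.log (1 / (1 - r)) := by
    rw [← integral_inv_one_sub_mul hr]
    refine intervalIntegral.integral_mono_on zero_le_one
      ((continuousOn_weight hr 1 0).mono (uIcc_of_le (zero_le_one' ℝ)).subset).intervalIntegrable
      (ContinuousOn.intervalIntegrable (ContinuousOn.inv₀ (by fun_prop) fun t ht => ?_))
      fun t ht => ?_
    · rw [uIcc_of_le zero_le_one] at ht
      linarith [(hrt t ht).2]
    · have h1 : 0 < 1 - r * t := by linarith [(hrt t ht).2]
      rw [d_ofReal (hrt t ht), mul_one, mul_zero, Real.rpow_zero, mul_one, Real.rpow_two,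
        inv_eq_one_div, div_le_div_iff₀ (by positivity) h1]
      -- This cancels one of the two factors `1 - rt` in the denominator.
      have h2 : 1 - t ≤ 1 - r * t := by nlinarith [hr.2, ht.1]
      nlinarith
  have hlog : 0 ≤ Real.log (1 / (1 - r)) :=
    Real.log_nonneg (by rw [le_div_iff₀ (by linarith [hr.2])]; linarith [hr.1])
  have hI0 : 0 ≤ ∫ t in (0 : ℝ)..1, (1 - t) / (d ((r * t : ℝ) : ℂ) ^ (2 * (1 : ℝ)) *
          Real.log (Real.exp 1 / d ((r * t : ℝ) : ℂ)) ^ (2 * (0 : ℝ))) := by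
    refine intervalIntegral.integral_nonneg zero_le_one fun t ht => ?_
    rw [mul_zero, Real.rpow_zero, mul_one]
    refine div_nonneg (by linarith [ht.2]) (Real.rpow_nonneg ?_ _)
    rw [d_ofReal (hrt t ht)]
    linarith [(hrt t ht).2]
  refine hmain.trans (Real.rpow_le_rpow (by positivity) ?_ (by norm_num))
  gcongr _ + ?_
  calc _ ≤ (r * p * N / 1) ^ 2 * (r⁻¹ * Real.log (1 / (1 - r))) := by gcongr
    _ = r * ((p * N) ^ 2 * Real.log (1 / (1 - r))) := by
      field_simp
    _ ≤ (p * N) ^ 2 * Real.log (1 / (1 - r)) :=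
      mul_le_of_le_one_left (by positivity) hr.2.le

theorem tendsto_log_one_div_one_sub :
    Tendsto (fun r : ℝ => Real.log (1 / (1 - r))) (𝓝[<] 1) atTop := by
  refine Real.tendsto_log_atTop.comp ?_
  simp only [one_div]
  refine tendsto_inv_nhdsGT_zero.comp (tendsto_nhdsWithin_iff.2 ⟨?_, ?_⟩)
  · have : Tendsto (fun r : ℝ => 1 - r) (𝓝 1) (𝓝 (1 - 1)) := by
      exact (continuous_const.sub continuous_id).tendsto 1
    simpa using this.mono_left nhdsWithin_le_nhds
  · filter_upwards [self_mem_nhdsWithin] with r hr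
    exact sub_pos.2 (mem_Iio.1 hr)

theorem integralMean_nonneg {E : Type*} [NormedAddCommGroup E] (p r : ℝ) (g : ℂ → E) :
    0 ≤ integralMean p r g :=
  Real.rpow_nonneg (Real.circleAverage_nonneg_of_nonneg fun z _ => by positivity) _

theorem harmonic_integralMean_isBigO {p : ℝ} {f : ℂ → ℂ} (hp : 2 ≤ p)
    (hf : IsYukawaSolution (fun _ => 0) f) (hfB : MemBloch p (fun t => t) 1 0 f) :
    (fun r : ℝ => integralMean p r f)
      =O[𝓝[<] 1] (fun r : ℝ => Real.log (1 / (1 - r)) ^ (1 / 2 : ℝ)) := by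
  set B := ‖f 0‖ ^ 2 + (p * blochNorm p (fun t => t) 1 0 f) ^ 2
  refine IsBigO.of_bound (B ^ (1 / 2 : ℝ)) ?_
  filter_upwards [Ioo_mem_nhdsLT one_pos, tendsto_log_one_div_one_sub.eventually_ge_atTop 1]
    with r hr hlog
  rw [Real.norm_of_nonneg (integralMean_nonneg _ _ _), Real.norm_of_nonneg (by positivity),
    ← Real.mul_rpow (by positivity) (by positivity)]
  refine (harmonic_integralMean_le hp hf hfB hr).trans
    (Real.rpow_le_rpow (by positivity) ?_ (by norm_num))
  -- The term `‖f 0‖²` is absorbed because the logarithm is at least `1` here.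
  nlinarith [sq_nonneg ‖f 0‖]

/-! ### The lacunary series belongs to the space. -/

theorem summable_pow_two_pow {x : ℝ} (hx0 : 0 ≤ x) (hx : x < 1) :
    Summable fun n : ℕ => x ^ (2 ^ n) :=
  (summable_geometric_of_lt_one hx0 hx).comp_injective (Nat.pow_right_injective le_rfl)

theorem summable_lacunary {z : ℂ} (hz : z ∈ disk) : Summable fun n : ℕ => z ^ (2 ^ n) :=
  Summable.of_norm (by simpa using summable_pow_two_pow (norm_nonneg z) (mem_disk.1 hz))

theorem differentiableOn_lacunary : DifferentiableOn ℂ lacunary disk := by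
  intro z hz
  obtain ⟨ρ, hzρ, hρ⟩ := exists_between (mem_disk.1 hz)
  have h : DifferentiableOn ℂ lacunary (Metric.ball 0 ρ) :=
    Complex.differentiableOn_tsum_of_summable_norm
      (summable_pow_two_pow ((norm_nonneg z).trans hzρ.le) hρ)
      (fun n => (differentiable_pow _).differentiableOn) Metric.isOpen_ball fun n w hw => by
        rw [norm_pow]
        exact pow_le_pow_left₀ (norm_nonneg _) (mem_ball_zero_iff.1 hw).le _
  exact (h.differentiableAt (Metric.isOpen_ball.mem_nhds
    (mem_ball_zero_iff.2 hzρ))).differentiableWithinAt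

theorem analyticOnNhd_lacunary : AnalyticOnNhd ℂ lacunary disk :=
  differentiableOn_lacunary.analyticOnNhd isOpen_disk

theorem isYukawaSolution_lacunary : IsYukawaSolution (fun _ => 0) lacunary := by
  refine ⟨fun z hz => (analyticOnNhd_lacunary z hz).harmonicAt.1.contDiffWithinAt, fun z hz => ?_⟩
  simpa using (analyticOnNhd_lacunary z hz).harmonicAt.2.eq_of_nhds

/-- Cauchy condensation compares the sum with the geometric series: it is at most `1 + 2ρ/(1-ρ) =
(1+ρ)/(1-ρ)`. -/
theorem sum_two_pow_mul_pow_le {ρ : ℝ} (h0 : 0 ≤ ρ) (h1 : ρ < 1) (n : ℕ) :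
    ∑ k ∈ Finset.range n, 2 ^ k * ρ ^ (2 ^ k - 1) ≤ 2 / (1 - ρ) := by
  have hpos : 0 < 1 - ρ := by linarith
  refine (Finset.sum_le_sum_of_subset_of_nonneg (Finset.range_mono n.le_succ)
    fun i _ _ => by positivity).trans ?_
  have h := Finset.sum_condensed_le (f := fun k => ρ ^ (k - 1))
    (fun m k _ hmk => pow_le_pow_of_le_one h0 h1.le (Nat.sub_le_sub_right hmk 1)) n
  simp only [nsmul_eq_mul, Nat.cast_pow, Nat.cast_ofNat, Nat.sub_self, pow_zero] at h
  refine h.trans ?_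
  have hgeom : ∑ k ∈ Finset.Ico 2 (2 ^ n + 1), ρ ^ (k - 1) ≤ ρ * (1 - ρ)⁻¹ := by
    rw [Finset.sum_Ico_eq_sum_range, ← tsum_geometric_of_lt_one h0 h1]
    calc _ = ρ * ∑ k ∈ Finset.range (2 ^ n + 1 - 2), ρ ^ k := by
          rw [Finset.mul_sum]
          refine Finset.sum_congr rfl fun k _ => ?_
          rw [← pow_succ']
          congr 1
          omega
      _ ≤ _ := mul_le_mul_of_nonneg_left
          ((summable_geometric_of_lt_one h0 h1).sum_le_tsum _ fun i _ => by positivity) h0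
  calc _ ≤ 1 + 2 * (ρ * (1 - ρ)⁻¹) := by linarith
    _ ≤ 2 / (1 - ρ) := by
      rw [le_div_iff₀ hpos]
      have : (1 - ρ)⁻¹ * (1 - ρ) = 1 := inv_mul_cancel₀ hpos.ne'
      linear_combination (2 * ρ) * this + h1

theorem norm_deriv_lacunary_le {z : ℂ} (hz : z ∈ disk) :
    ‖deriv lacunary z‖ ≤ 2 / (1 - ‖z‖) := by
  obtain ⟨ρ, hzρ, hρ⟩ := exists_between (mem_disk.1 hz)
  have h : HasSum (fun n : ℕ => deriv (fun w : ℂ => w ^ (2 ^ n)) z) (deriv lacunary z) :=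
    Complex.hasSum_deriv_of_summable_norm
      (summable_pow_two_pow ((norm_nonneg z).trans hzρ.le) hρ)
      (fun n => (differentiable_pow _).differentiableOn) Metric.isOpen_ball (fun n w hw => by
        rw [norm_pow]
        exact pow_le_pow_left₀ (norm_nonneg _) (mem_ball_zero_iff.1 hw).le _)
      (mem_ball_zero_iff.2 hzρ)
  refine le_of_tendsto h.tendsto_sum_nat.norm (Eventually.of_forall fun n => ?_)
  refine (norm_sum_le _ _).trans (le_trans (le_of_eq ?_)
    (sum_two_pow_mul_pow_le (norm_nonneg z) (mem_disk.1 hz) n))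
  refine Finset.sum_congr rfl fun k _ => ?_
  simp

theorem norm_fderiv_lacunary_le {z : ℂ} (hz : z ∈ disk) :
    ‖fderiv ℝ lacunary z‖ ≤ 2 / (1 - ‖z‖) := by
  have h := ((analyticOnNhd_lacunary z hz).differentiableAt.hasDerivAt.hasFDerivAt).restrictScalars ℝ
  have hpos : 0 < 1 - ‖z‖ := by linarith [mem_disk.1 hz]
  rw [h.fderiv]
  refine ContinuousLinearMap.opNorm_le_bound _ (by positivity) fun v => ?_
  simp only [ContinuousLinearMap.coe_restrictScalars', ContinuousLinearMap.toSpanSingleton_apply,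
    smul_eq_mul, norm_mul]
  rw [mul_comm]
  exact mul_le_mul_of_nonneg_right (norm_deriv_lacunary_le hz) (norm_nonneg _)

theorem memBloch_lacunary {p : ℝ} (hp : 0 < p) : MemBloch p (fun t => t) 1 0 lacunary := by
  have hC := isYukawaSolution_lacunary.1
  refine ⟨hC.of_le (by norm_num), 2, ?_⟩
  rintro _ ⟨z, hz, rfl⟩
  have hz1 := mem_disk.1 hz
  have hpos : 0 < 1 - ‖z‖ := by linarith
  have ht : ‖z‖ ∈ Ioo (-1 : ℝ) 1 := ⟨by linarith [norm_nonneg z], hz1⟩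
  have hi : CircleIntegrable (fun w => ‖fderiv ℝ lacunary w‖ ^ p) 0 ‖z‖ :=
    circleIntegrable_of_continuousOn_disk
      ((hC.continuousOn_fderiv_of_isOpen isOpen_disk (by norm_num)).norm.rpow_const
        fun _ _ => Or.inr hp.le) ht
  have havg : Real.circleAverage (fun w => ‖fderiv ℝ lacunary w‖ ^ p) 0 ‖z‖ ≤
      (2 / (1 - ‖z‖)) ^ p := by
    refine Real.circleAverage_mono_on_of_le_circle hi fun w hw => ?_
    have hwz : ‖w‖ = ‖z‖ := by simpa using hw
    have h := norm_fderiv_lacunary_le (sphere_subset_disk ht hw)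
    rw [hwz] at h
    gcongr
  have hM : integralMean p ‖z‖ (fun w => ‖fderiv ℝ lacunary w‖) ≤ 2 / (1 - ‖z‖) := by
    simp only [integralMean, norm_norm]
    refine (Real.rpow_le_rpow (Real.circleAverage_nonneg_of_nonneg fun w _ => by positivity) havg
      (by positivity)).trans (le_of_eq ?_)
    rw [← Real.rpow_mul (by positivity), mul_one_div_cancel hp.ne', Real.rpow_one]
  rw [blochQuantity, d_eq hz, Real.rpow_one, Real.rpow_zero, mul_one]
  exact (le_div_iff₀ hpos).1 hM

/-! ### Lower bound for the means of the lacunary series. -/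

theorem lacunary_eq_add {z : ℂ} (hz : z ∈ disk) : lacunary z = z + lacunary (z ^ 2) := by
  rw [lacunary, (summable_lacunary hz).tsum_eq_zero_add]
  simp [lacunary, pow_succ', pow_mul]

theorem circleAverage_comp_neg (g : ℂ → ℝ) (r : ℝ) :
    Real.circleAverage (fun z => g (-z)) 0 r = Real.circleAverage g 0 r := by
  rw [← Real.circleAverage_neg_radius (f := g)]
  simp only [Real.circleAverage_def]
  congr 2
  funext θ
  simp [circleMap]

theorem circleAverage_comp_sq {g : ℂ → ℝ} (hg : ContinuousOn g disk) {r : ℝ}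
    (hr : r ∈ Ioo (-1 : ℝ) 1) :
    Real.circleAverage (fun z => g (z ^ 2)) 0 r = Real.circleAverage g 0 (r ^ 2) := by
  have hr2 : r ^ 2 ∈ Ioo (-1 : ℝ) 1 :=
    ⟨by linarith [sq_nonneg r], (sq_lt_one_iff_abs_lt_one r).2 (abs_lt.2 hr)⟩
  have hG : Continuous fun θ => g (circleMap 0 (r ^ 2) θ) :=
    hg.comp_continuous (by fun_prop) fun θ => circleMap_mem_disk hr2 θ
  have hper : Function.Periodic (fun θ => g (circleMap 0 (r ^ 2) θ)) (2 * π) :=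
    fun θ => by simp only [periodic_circleMap 0 (r ^ 2) θ]
  have h1 : ∀ θ : ℝ, circleMap 0 r θ ^ 2 = circleMap 0 (r ^ 2) (2 * θ) := fun θ => by
    simp only [circleMap, zero_add, mul_pow, ← Complex.exp_nat_mul]
    push_cast
    ring_nf
  simp only [Real.circleAverage_def, h1]
  congr 1
  -- Squaring doubles the angle, so the circle is covered twice; periodicity makes the two halves
  -- equal.
  rw [intervalIntegral.integral_comp_mul_left (fun θ => g (circleMap 0 (r ^ 2) θ)) two_ne_zero,
    mul_zero, ← intervalIntegral.integral_add_adjacent_intervals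
      (hG.intervalIntegrable 0 (2 * π)) (hG.intervalIntegrable (2 * π) (2 * (2 * π))),
    two_mul (2 * π), hper.intervalIntegral_add_eq (2 * π) 0, zero_add, smul_eq_mul]
  ring

/-- This replaces Parseval's identity. At `z` and `-z` the series takes the values `f(z²) ± z`, so
the parallelogram law removes the cross term, and both points contribute equally to the average. -/
theorem circleAverage_normSq_lacunary {r : ℝ} (hr : r ∈ Ioo (-1 : ℝ) 1) :
    Real.circleAverage (fun z => ‖lacunary z‖ ^ 2) 0 r =
      r ^ 2 + Real.circleAverage (fun z => ‖lacunary z‖ ^ 2) 0 (r ^ 2) := by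
  have hc : ContinuousOn (fun z => ‖lacunary z‖ ^ 2) disk :=
    differentiableOn_lacunary.continuousOn.norm.pow 2
  have hneg : ∀ {z : ℂ}, z ∈ disk → -z ∈ disk := fun hz => by
    rw [mem_disk, norm_neg]; exact mem_disk.1 hz
  have hsq : ∀ {z : ℂ}, z ∈ disk → z ^ 2 ∈ disk := fun hz => by
    rw [mem_disk, norm_pow]; exact pow_lt_one₀ (norm_nonneg _) (mem_disk.1 hz) two_ne_zero
  have hi := circleIntegrable_of_continuousOn_disk hc hr
  have hin : CircleIntegrable (fun z => ‖lacunary (-z)‖ ^ 2) 0 r := circleIntegrable_of_continuousOn_disk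
    (hc.comp continuousOn_neg fun z hz => hneg hz) hr
  have his : CircleIntegrable (fun z => ‖lacunary (z ^ 2)‖ ^ 2) 0 r := circleIntegrable_of_continuousOn_disk
    (hc.comp (continuousOn_pow 2) fun z hz => hsq hz) hr
  have hconst : CircleIntegrable (fun _ : ℂ => r ^ 2) 0 r :=
    circleIntegrable_of_continuousOn_disk continuousOn_const hr
  have h1 : Real.circleAverage (fun z => ‖lacunary z‖ ^ 2 + ‖lacunary (-z)‖ ^ 2) 0 r =
      Real.circleAverage (fun z => (2 : ℝ) • (r ^ 2 + ‖lacunary (z ^ 2)‖ ^ 2)) 0 r := by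
    refine Real.circleAverage_congr_sphere fun z hz => ?_
    have hzd := sphere_subset_disk hr hz
    have hzr : r ^ 2 = ‖z‖ ^ 2 := by rw [mem_sphere_zero_iff_norm.1 hz, sq_abs]
    have hpar := parallelogram_law_with_norm ℝ (lacunary (z ^ 2)) z
    simp only [smul_eq_mul]
    rw [lacunary_eq_add hzd, lacunary_eq_add (hneg hzd), hzr, neg_sq, neg_add_eq_sub, add_comm z]
    linarith
  rw [Real.circleAverage_fun_add hi hin, circleAverage_comp_neg fun z => ‖lacunary z‖ ^ 2,
    Real.circleAverage_fun_smul, Real.circleAverage_fun_add hconst his, Real.circleAverage_const,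
    circleAverage_comp_sq hc hr, smul_eq_mul] at h1
  linarith

theorem sum_pow_le_circleAverage_normSq_lacunary (N : ℕ) {r : ℝ} (hr : r ∈ Ico (0 : ℝ) 1) :
    ∑ n ∈ Finset.range N, r ^ (2 ^ (n + 1)) ≤
      Real.circleAverage (fun z => ‖lacunary z‖ ^ 2) 0 r := by
  induction N generalizing r with
  | zero => simpa using Real.circleAverage_nonneg_of_nonneg fun z _ => sq_nonneg ‖lacunary z‖
  | succ N ih =>
    have h := ih (r := r ^ 2) ⟨sq_nonneg r, pow_lt_one₀ hr.1 hr.2 two_ne_zero⟩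
    rw [circleAverage_normSq_lacunary ⟨by linarith [hr.1], hr.2⟩, Finset.sum_range_succ']
    simp only [← pow_mul, ← pow_succ'] at h
    simp only [zero_add, pow_one]
    linarith

theorem log_le_circleAverage_normSq_lacunary {r : ℝ} (hr : r ∈ Ico (0 : ℝ) 1)
    (hlog : 4 ≤ Real.log (1 / (1 - r))) :
    Real.log (1 / (1 - r)) / 4 ≤ Real.circleAverage (fun z => ‖lacunary z‖ ^ 2) 0 r := by
  set l := Real.log (1 / (1 - r)) with hl
  have hpos : 0 < 1 - r := by linarith [hr.2]
  -- This choice gives `2^N ≤ exp(l - 1) = 1/(e(1-r))`, so Bernoulli makes each of the `N` terms at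
  -- least `1/2`. Also `N > l - 2`, and `(l - 2)/2 ≥ l/4` exactly when `l ≥ 4`.
  set N := ⌊l - 1⌋₊ with hN
  have hN1 : (N : ℝ) ≤ l - 1 := Nat.floor_le (by linarith)
  have hN2 : l - 1 < N + 1 := Nat.lt_floor_add_one _
  have h2e : (2 : ℝ) ≤ Real.exp 1 := by linarith [Real.add_one_le_exp 1]
  have hpow : (2 : ℝ) ^ N * (1 - r) ≤ 1 / 2 := by
    have h1 : (2 : ℝ) ^ N ≤ Real.exp (l - 1) := by
      calc (2 : ℝ) ^ N ≤ Real.exp 1 ^ N := by gcongr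
        _ = Real.exp N := by rw [← Real.exp_nat_mul, mul_one]
        _ ≤ Real.exp (l - 1) := Real.exp_le_exp.2 hN1
    have h2 : Real.exp (l - 1) * (1 - r) = 1 / Real.exp 1 := by
      rw [Real.exp_sub, hl, Real.exp_log (by positivity)]
      field_simp
    calc (2 : ℝ) ^ N * (1 - r) ≤ Real.exp (l - 1) * (1 - r) := by gcongr
      _ = 1 / Real.exp 1 := h2
      _ ≤ 1 / 2 := by gcongr
  have hterm : ∀ n ∈ Finset.range N, (1 / 2 : ℝ) ≤ r ^ (2 ^ (n + 1)) := fun n hn => by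
    have hb := one_add_mul_le_pow (a := r - 1) (by linarith [hr.1]) (2 ^ (n + 1))
    have h3 : (2 : ℝ) ^ (n + 1) ≤ 2 ^ N :=
      pow_le_pow_right₀ one_le_two (Finset.mem_range.1 hn)
    push_cast at hb
    rw [add_sub_cancel] at hb
    nlinarith
  have hsum := Finset.card_nsmul_le_sum _ _ _ hterm
  rw [Finset.card_range, nsmul_eq_mul] at hsum
  have := sum_pow_le_circleAverage_normSq_lacunary N hr
  linarith

theorem circleAverage_normSq_le_integralMean_sq {f : ℂ → ℂ} (hf : ContinuousOn f disk) {p : ℝ}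
    (hp : 2 ≤ p) {r : ℝ} (hr : r ∈ Ioo (-1 : ℝ) 1) :
    Real.circleAverage (fun z => ‖f z‖ ^ 2) 0 r ≤ integralMean p r f ^ 2 := by
  have hp0 : 0 < p := by linarith
  have e : ∀ z, (1 : ℝ) ^ (1 - 2 / p) * (‖f z‖ ^ p) ^ (2 / p) = ‖f z‖ ^ 2 := fun z => by
    rw [Real.one_rpow, one_mul, ← Real.rpow_mul (norm_nonneg _), mul_div_cancel₀ _ hp0.ne',
      Real.rpow_two]
  -- Hölder against the constant `1` yields `M₂ ≤ M_p`.
  have h := circleAverage_rpow_mul_rpow_le (X := fun _ => 1) (Y := fun z => ‖f z‖ ^ p)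
    (t := r) (w := 2 / p) (P := 1) (fun _ => zero_le_one) (fun z => by positivity)
    (circleIntegrable_of_continuousOn_disk continuousOn_const hr)
    (circleIntegrable_of_continuousOn_disk (hf.norm.rpow_const fun _ _ => Or.inr hp0.le) hr)
    (by
      simp only [e]
      exact circleIntegrable_of_continuousOn_disk (hf.norm.pow 2) hr)
    (by positivity) ((div_le_one hp0).2 hp) one_pos (Real.circleAverage_const _ _ _).le le_rfl
  simp only [e] at h
  rw [Real.one_rpow, one_mul] at h
  refine h.trans_eq ?_
  rw [integralMean, ← Real.rpow_two, ← Real.rpow_mul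
    (Real.circleAverage_nonneg_of_nonneg fun z _ => by positivity)]
  congr 1
  ring

theorem isBigO_integralMean_lacunary {p : ℝ} (hp : 2 ≤ p) :
    (fun r : ℝ => Real.log (1 / (1 - r)) ^ (1 / 2 : ℝ))
      =O[𝓝[<] 1] (fun r : ℝ => integralMean p r lacunary) := by
  refine IsBigO.of_bound 2 ?_
  filter_upwards [Ioo_mem_nhdsLT one_pos, tendsto_log_one_div_one_sub.eventually_ge_atTop 4]
    with r hr hlog
  have hM := integralMean_nonneg p r lacunary
  rw [Real.norm_of_nonneg hM, Real.norm_of_nonneg (by positivity), ← Real.sqrt_eq_rpow]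
  refine Real.sqrt_le_iff.2 ⟨by positivity, ?_⟩
  have h1 := log_le_circleAverage_normSq_lacunary ⟨hr.1.le, hr.2⟩ hlog
  have h2 := circleAverage_normSq_le_integralMean_sq differentiableOn_lacunary.continuousOn hp
    (r := r) ⟨by linarith [hr.1], hr.2⟩
  linarith

end YukawaBloch

theorem mainTheorem7 :
    -- the estimate
    (∀ (ω : ℝ → ℝ) (p α β : ℝ) (lam : ℂ → ℝ) (f : ℂ → ℂ),
      YukawaBloch.IsMajorant ω → 2 ≤ p → 0 < α → β ≤ α →
      ContinuousOn lam YukawaBloch.disk → (∀ z ∈ YukawaBloch.disk, 0 ≤ lam z) →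
      BddAbove (lam '' YukawaBloch.disk) → sSup (lam '' YukawaBloch.disk) < 4 / p →
      YukawaBloch.IsYukawaSolution lam f →
      YukawaBloch.MemBloch p ω α β f →
      ∀ r ∈ Ioo (0 : ℝ) 1,
        YukawaBloch.integralMean p r f ≤
          YukawaBloch.yukawaConst lam p r *
            (‖f 0‖ ^ 2 + (r * p * YukawaBloch.blochNorm p ω α β f / ω 1) ^ 2 *
              ∫ t in (0 : ℝ)..1, (1 - t) /
                (YukawaBloch.d ((r * t : ℝ) : ℂ) ^ (2 * α) *
                  Real.log (Real.exp 1 / YukawaBloch.d ((r * t : ℝ) : ℂ)) ^ (2 * β)))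
              ^ (1 / 2 : ℝ)) ∧
    -- the classical case
    (∀ (p : ℝ) (f : ℂ → ℂ), 2 ≤ p →
      YukawaBloch.IsYukawaSolution (fun _ => 0) f →
      YukawaBloch.MemBloch p (fun t => t) 1 0 f →
      (fun r : ℝ => YukawaBloch.integralMean p r f)
        =O[𝓝[<] 1] (fun r : ℝ => Real.log (1 / (1 - r)) ^ (1 / 2 : ℝ))) ∧
    -- sharpness in the classical case
    ((∀ z ∈ YukawaBloch.disk, Summable fun n : ℕ => z ^ (2 ^ n)) ∧
      YukawaBloch.IsYukawaSolution (fun _ => 0) YukawaBloch.lacunary ∧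
      ∀ p : ℝ, 2 ≤ p →
        YukawaBloch.MemBloch p (fun t => t) 1 0 YukawaBloch.lacunary ∧
        (fun r : ℝ => YukawaBloch.integralMean p r YukawaBloch.lacunary)
          =Θ[𝓝[<] 1] (fun r : ℝ => Real.log (1 / (1 - r)) ^ (1 / 2 : ℝ))) := by
  refine ⟨?_, ?_, ?_, ?_, ?_⟩
  · intro ω p α β lam f hω hp hα hβ _ hlam0 hbdd hsup hf hfB r hr
    exact YukawaBloch.integralMean_le hω hp hα hβ hlam0 hbdd hsup hf hfB hr
  · intro p f hp hf hfB
    exact YukawaBloch.harmonic_integralMean_isBigO hp hf hfB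
  · exact fun z hz => YukawaBloch.summable_lacunary hz
  · exact YukawaBloch.isYukawaSolution_lacunary
  · intro p hp
    have hmem := YukawaBloch.memBloch_lacunary (by linarith : 0 < p)
    exact ⟨hmem, YukawaBloch.harmonic_integralMean_isBigO hp
      YukawaBloch.isYukawaSolution_lacunary hmem, YukawaBloch.isBigO_integralMean_lacunary hp⟩
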